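/- **Setting.** Let $n\ge 1$, $\mathcal X\subseteq\mathbb R^n$ with the Euclidean distance, actions $\{0,1\}$ and an extra action "query the mentor". A policy is a map $\mathcal X\to\{0,1\}$; $\Pi$ is a policy class and the mentor has a policy $\pi^m\in\Pi$. Let $T\ge 1$ be the horizon. In each round $t=1,\dots,T$ an adaptive (possibly randomized) adversary, knowing all events of the earlier rounds, chooses an input $x_t\in\mathcal X$ and a payoff function $\mu_t:\mathcal X\times\{0,1\}\to[0,1]$; then the agent takes an action $y_t\in\{0,1\}$ or queries the mentor. A query reveals $\pi^m(x_t)$ and yields the mentor's payoff $\mu_t^m(x_t):=\mu_t(x_t,\pi^m(x_t))$; the agent's payoff is also written $\mu_t(x_t,y_t)$ in that case. Payoffs are not observed. Assume, with constants $L>0$ and $\mu_{\min}>0$, - local generalization: $|\mu_t(x,\pi^m(x))-\mu_t(x,\pi^m(x'))|\le L\|x-x'\|$ for all $t$ and $x,x'\in\mathcal X$; - $\mu_t^m(x_t)\ge\mu_{\min}$ always. Let $Q_T$ be the set of rounds with a query and $\operatorname{diam}(\mathbf x)=\max_{s,t\le T}\|x_s-x_t\|$. Put $R^+_T=\sum_{t}\mu^m_t(x_t)-\sum_t\mu_t(x_t,y_t)$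 and $R^\times_T=\log\prod_t\mu^m_t(x_t)-\log\prod_t\mu_t(x_t,y_t)$, where $R^\times_T=\infty$ if some $\mu_t(x_t,y_t)=0$. Assume one of the following, with an integer $d\ge1$. - *Case 1.* $\Pi$ has VC dimension $d$, and the inputs are $\sigma$-smooth, $\sigma>0$: there is a probability measure $U$ on $\mathcal X$ (for instance the uniform distribution) such that, given the events of the earlier rounds, $\Pr[x_t\in B]\le U(B)/\sigma$ for all measurable $B\subseteq\mathcal X$ and all $t$. - *Case 2.* $\Pi$ has Littlestone dimension $d$; here put $\sigma=1$. **Algorithm.** Let $\varepsilon>0$. The algorithm uses any finite set $\tilde\Pi$ of the following kind. In Case 1: a *smooth $\varepsilon$-cover* of $\Pi$, that is, a set of measurable policies such that every $\pi\in\Pi$ has some $\tilde\pi\in\tilde\Pi$ with $U\{\pi\ne\tilde\pi\}\le\varepsilon$, with $|\tilde\Pi|\le(41/\varepsilon)^d$. In Case 2: an *adversarial cover* of $\Pi$, that is, a set of experts (policies whose action in round $t$ may also depend on $x_1,\dots,x_{t-1}$; we still write $\tilde\pi(x_t)$) such that for every $\pi\in\Pi$ and every input sequence of length $T$ some $\tilde\pi\in\tilde\Pi$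 agrees with $\pi$ in all rounds, with $|\tilde\Pi|\le(eT/d)^d$. Set $p=1/\sqrt{\varepsilon T}$, $\eta=\max\big(\sqrt{p\log|\tilde\Pi|/(2T)},\,p^2/\sqrt2\big)$, $S=\emptyset$ and $w(\pi)=1$ for $\pi\in\tilde\Pi$. In round $t$: 1. With probability $p$, independently of everything so far, make a *Hedge query*: query the mentor, let $\ell(t,\pi)=\mathbf 1(\pi(x_t)\neq\pi^m(x_t))$ and $\ell^*=\min_{\pi\in\tilde\Pi}\ell(t,\pi)$, multiply each $w(\pi)$ by $\exp\!\big(-\eta\,(\ell(t,\pi)-\ell^*)/p\big)$, and let $\pi_t$ be a minimizer of $\ell(t,\cdot)$ (ties broken arbitrarily). Otherwise sample $\pi_t\in\tilde\Pi$ with probability $w(\pi_t)/\sum_{\pi}w(\pi)$. 2. If $\|x_t-x\|>\varepsilon^{1/n}$ for all $(x,y)\in S$ with $y=\pi_t(x_t)$, query the mentor (if not already queried in this round) and add $(x_t,\pi^m(x_t))$ to $S$. Otherwise, if there was no Hedge query, take the action $\pi_t(x_t)$. The claims below hold both for this version and for the version that also adds $(x_t,\pi^m(x_t))$ to $S$ in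 every round with a Hedge query. **Theorem.** (a) The covers exist: if all policies in $\Pi$ are measurable, $\Pi$ has VC dimension $d\ge1$ and $0<\varepsilon\le41$, then for every probability measure $U$ on $\mathcal X$ there is a smooth $\varepsilon$-cover of $\Pi$ of size at most $(41/\varepsilon)^d$; if $\Pi$ has Littlestone dimension $d$ with $1\le d\le T$, there is an adversarial cover of $\Pi$ of size at most $(eT/d)^d$. (b) There are an absolute constant $c$ and a constant $c'$ that depends only on $n$ such that in Case 1 and in Case 2, if $\frac1T\le\varepsilon\le\big(\frac{\mu_{\min}}{2L}\big)^n$, the algorithm (with any such cover) satisfies $$\mathbb E[R^\times_T]\le c\,\frac{dL}{\sigma\mu_{\min}}\,T\varepsilon^{1+1/n}\log(T+1/\varepsilon),\qquad \mathbb E[R^+_T]\le c\,\frac{dL}{\sigma}\,T\varepsilon^{1+1/n}\log(T+1/\varepsilon),$$ where both expectations are finite and $R^\times_T<\infty$ almost surely, and $$\mathbb E[|Q_T|]\le c'\Big(\sqrt{T/\varepsilon}+\frac d\sigma T\varepsilon\log(T+1/\varepsilon)+\frac{\mathbb E[\operatorname{diam}(\mathbf x)^n]}{\varepsilon}\Big).$$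 -/

import Mathlib

open MeasureTheory ProbabilityTheory
open scoped ENNReal

noncomputable section

namespace AskForHelp

/-! ### Policies and their combinatorial dimensions (actions are `Bool`) -/

/-- A (stationary) policy on the input space `X`. -/
abbrev Policy (X : Type*) := X → Bool

/-- A member of a cover: it predicts an action for the current input and may also look at the list
of the inputs of the earlier rounds. Ordinary policies are the experts that ignore this list. -/
abbrev Expert (X : Type*) := List X → X → Bool

/-- A policy, regarded as an expert. -/
def Policy.toExpert {X : Type*} (π : Policy X) : Expert X := fun _ x => π x

/-- `C` shatters the finite set `s`: every labelling of `s` is realized by a member of `C`. -/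
def Shatters {X : Type*} (C : Set (Policy X)) (s : Finset X) : Prop :=
  ∀ f : X → Bool, ∃ π ∈ C, ∀ x ∈ s, π x = f x

/-- The VC dimension: the largest size of a shattered set. -/
def vcDim {X : Type*} (C : Set (Policy X)) : ℕ∞ :=
  ⨆ (s : Finset X) (_ : Shatters C s), (s.card : ℕ∞)

/-- `C` shatters some complete binary tree of depth `k` with nodes labelled by inputs. The node
reached by the path `b₀, …, bᵢ₋₁` carries the input `v [b₀, …, bᵢ₋₁]`. Every root-to-leaf path has
to be realized by a member of `C`. -/
def ShattersTree {X : Type*} (C : Set (Policy X)) (k : ℕ) : Prop :=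
  ∃ v : List Bool → X, ∀ b : Fin k → Bool, ∃ π ∈ C, ∀ i : Fin k,
    π (v ((List.ofFn b).take i)) = b i

/-- The Littlestone dimension: the largest depth of a shattered tree. -/
def littlestoneDim {X : Type*} (C : Set (Policy X)) : ℕ∞ :=
  ⨆ (k : ℕ) (_ : ShattersTree C k), (k : ℕ∞)

/-! ### Covers -/

/-- The inputs of the rounds `0, …, t - 1`. -/
def past {X : Type*} (x : ℕ → X) (t : ℕ) : List X := (List.range t).map x

/-- A finite set of (measurable) policies is a smooth `ε`-cover of `C` with respect to `U` if each
`π ∈ C` differs from some member of it with `U`-probability at most `ε`. -/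
def IsSmoothCover {X : Type*} [MeasurableSpace X] (U : Measure X) (ε : ℝ) (C : Set (Policy X))
    (K : Finset (Expert X)) : Prop :=
  (∀ e ∈ K, ∃ π' : Policy X, Measurable π' ∧ e = π'.toExpert) ∧
  ∀ π ∈ C, ∃ π' : Policy X, Measurable π' ∧ π'.toExpert ∈ K ∧
    U {x | π x ≠ π' x} ≤ ENNReal.ofReal ε

/-- A finite set of experts is an adversarial cover of `C` for the horizon `T` if for each `π ∈ C`
and each input sequence some member of it agrees with `π` in all rounds. -/
def IsAdversarialCover {X : Type*} (T : ℕ) (C : Set (Policy X)) (K : Finset (Expert X)) : Prop :=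
  ∀ π ∈ C, ∀ x : ℕ → X, ∃ e ∈ K, ∀ t < T, e (past x t) (x t) = π (x t)

/-! ### The algorithm -/

/-- What the algorithm is given. -/
structure Params (X : Type*) where
  /-- dimension of the ambient Euclidean space -/
  n : ℕ
  /-- time horizon -/
  T : ℕ
  /-- accuracy -/
  ε : ℝ
  /-- the finite cover of the policy class -/
  cover : Finset (Expert X)
  /-- In a round with a Hedge query and a familiar input, is the labelled input stored? -/
  storeAll : Bool

namespace Params

variable {X : Type*} (A : Params X)

/-- Probability of a Hedge query, `p = 1 / √(ε T)`. -/
def p : ℝ := 1 / √(A.ε * A.T)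

/-- The learning rate. -/
def η : ℝ := max √(A.p * Real.log A.cover.card / (2 * A.T)) (A.p ^ 2 / √2)

/-- The distance beyond which an input is unfamiliar. -/
def radius : ℝ := A.ε ^ (1 / (A.n : ℝ))

end Params

/-- State of the algorithm at the start of a round: the Hedge weights and the set `S` of stored
inputs with their mentor actions. -/
structure AgentState (X : Type*) where
  weight : Expert X → ℝ
  memory : Set (X × Bool)

section Run

variable {X : Type*} [PseudoMetricSpace X]

/-- The 0-1 loss of an expert in round `t`, for the mentor policy `m`. -/
def loss (m : Policy X) (x : ℕ → X) (t : ℕ) (e : Expert X) : ℝ :=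
  if e (past x t) (x t) = m (x t) then 0 else 1

/-- The smallest loss in round `t` in the cover. -/
def minLoss (A : Params X) (m : Policy X) (x : ℕ → X) (t : ℕ) : ℝ :=
  ⨅ e : A.cover, loss m x t e

/-- The current input `z` is unfamiliar, if `y` is the action of the policy selected by Hedge: all
stored inputs with mentor action `y` (possibly there are none) are further away than the radius. -/
def Unfamiliar (A : Params X) (s : AgentState X) (z : X) (y : Bool) : Prop :=
  ∀ q ∈ s.memory, q.2 = y → A.radius < dist z q.1

open Classical in
/-- The state at the start of round `t` (rounds are numbered from `0`), as a function of the inputs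
`x`, the Hedge-query coins `c` and the policies `h` selected by Hedge. -/
def stateAt (A : Params X) (m : Policy X) (x : ℕ → X) (c : ℕ → Bool) (h : ℕ → Expert X) :
    ℕ → AgentState X
  | 0 => ⟨fun _ => 1, ∅⟩
  | t + 1 =>
    let s := stateAt A m x c h t
    { weight := fun e =>
        if c t = true then
          s.weight e * Real.exp (-A.η * ((loss m x t e - minLoss A m x t) / A.p))
        else s.weight e
      memory :=
        if Unfamiliar A s (x t) (h t (past x t) (x t)) ∨ (A.storeAll = true ∧ c t = true) then
          insert (x t, m (x t)) s.memory
        else s.memory }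

open Classical in
/-- The action in round `t`; `none` is the query to the mentor. -/
def action (A : Params X) (m : Policy X) (x : ℕ → X) (c : ℕ → Bool) (h : ℕ → Expert X) (t : ℕ) :
    Option Bool :=
  if c t = true ∨ Unfamiliar A (stateAt A m x c h t) (x t) (h t (past x t) (x t)) then none
  else some (h t (past x t) (x t))

/-- The probability with which Hedge samples `e` in a round without a Hedge query. -/
def hedgeProb (A : Params X) (s : AgentState X) (e : Expert X) : ℝ :=
  s.weight e / ∑ e' ∈ A.cover, s.weight e'

end Run

/-! ### Playing against an adaptive adversary -/

/-- The payoff of an action at the input `z`; a query earns the payoff of the mentor's action. -/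
def payoffOf {X : Type*} (m : Policy X) (μ : X → Bool → ℝ) (z : X) : Option Bool → ℝ
  | none => μ z (m z)
  | some y => μ z y

/-- A random run of the algorithm with parameters `A` and mentor policy `m` against an adaptive
adversary, on the probability space `(Ω, P)`. In round `t` the adversary first chooses the input
and the payoff function, possibly at random and depending on everything that happened earlier
(`before t`); `during t` is the information available after this choice. Then the algorithm
randomizes, with the prescribed conditional distribution given `during t`. -/
structure Play {X : Type*} [PseudoMetricSpace X] [MeasurableSpace X] (A : Params X) (m : Policy X)
    {Ω : Type*} [mΩ : MeasurableSpace Ω] (P : Measure Ω) where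
  /-- the inputs `xₜ` -/
  input : ℕ → Ω → X
  /-- the payoff functions `μₜ` -/
  payoff : ℕ → Ω → X → Bool → ℝ
  /-- is there a Hedge query in round `t`? -/
  coin : ℕ → Ω → Bool
  /-- the policy `πₜ` selected by Hedge -/
  draw : ℕ → Ω → Expert X
  /-- the events of the rounds before `t` -/
  before : Filtration ℕ mΩ
  /-- these, together with the adversary's choice in round `t` -/
  during : Filtration ℕ mΩ
  before_le_during : ∀ t, before t ≤ during t
  during_le_before_succ : ∀ t, during t ≤ before (t + 1)
  measurable_input : ∀ t < A.T, Measurable[during t] (input t)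
  measurable_payoff : ∀ t < A.T, ∀ y, Measurable[during t] fun ω => payoff t ω (input t ω) y
  measurable_mentor : ∀ t < A.T, Measurable[during t] fun ω => m (input t ω)
  measurable_expert : ∀ t < A.T, ∀ e ∈ A.cover,
    Measurable[during t] fun ω => e (past (fun s => input s ω) t) (input t ω)
  measurable_coin : ∀ t < A.T, Measurable[before (t + 1)] (coin t)
  measurable_draw : ∀ t < A.T, ∀ e ∈ A.cover, MeasurableSet[before (t + 1)] {ω | draw t ω = e}
  payoff_mem : ∀ t < A.T, ∀ ω z y, payoff t ω z y ∈ Set.Icc (0 : ℝ) 1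
  /-- a Hedge query happens with probability `p`, independently of the past and of the adversary's
  choice -/
  coin_law : ∀ t < A.T,
    P[{ω | coin t ω = true}.indicator (fun _ => (1 : ℝ)) | during t] =ᵐ[P] fun _ => A.p
  draw_mem : ∀ t < A.T, ∀ ω, draw t ω ∈ A.cover
  /-- in a round with a Hedge query a policy of smallest loss is selected (ties are broken in any
  way) -/
  draw_of_coin : ∀ t < A.T, ∀ ω, coin t ω = true → ∀ e ∈ A.cover,
    loss m (fun s => input s ω) t (draw t ω) ≤ loss m (fun s => input s ω) t e
  /-- in the other rounds the policy is sampled proportionally to the weights -/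
  draw_law : ∀ t < A.T, ∀ e ∈ A.cover,
    P[{ω | coin t ω = false ∧ draw t ω = e}.indicator (fun _ => (1 : ℝ)) | during t] =ᵐ[P]
      fun ω => (1 - A.p) * hedgeProb A
        (stateAt A m (fun s => input s ω) (fun s => coin s ω) (fun s => draw s ω) t) e

namespace Play

variable {X : Type*} [PseudoMetricSpace X] [MeasurableSpace X] {A : Params X} {m : Policy X}
  {Ω : Type*} [mΩ : MeasurableSpace Ω] {P : Measure Ω} (G : Play A m P)

/-- The agent's action in round `t`. -/
def act (t : ℕ) (ω : Ω) : Option Bool :=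
  action A m (fun s => G.input s ω) (fun s => G.coin s ω) (fun s => G.draw s ω) t

/-- The agent's payoff in round `t`. -/
def agentPayoff (t : ℕ) (ω : Ω) : ℝ := payoffOf m (G.payoff t ω) (G.input t ω) (G.act t ω)

/-- The mentor's payoff in round `t`. -/
def mentorPayoff (t : ℕ) (ω : Ω) : ℝ := G.payoff t ω (G.input t ω) (m (G.input t ω))

/-- The number of queries. -/
def numQueries (ω : Ω) : ℕ := ((Finset.range A.T).filter fun t => G.act t ω = none).card

/-- The diameter of the set of inputs. -/
def inputDiam (ω : Ω) : ℝ := Metric.diam ((fun t => G.input t ω) '' Set.Iio A.T)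

/-- Additive regret. -/
def addRegret (ω : Ω) : ℝ :=
  ∑ t ∈ Finset.range A.T, G.mentorPayoff t ω - ∑ t ∈ Finset.range A.T, G.agentPayoff t ω

open Classical in
/-- Multiplicative regret; it is `∞` if the agent has a payoff `0`. -/
def mulRegret (ω : Ω) : EReal :=
  if ∀ t < A.T, 0 < G.agentPayoff t ω then
    ((Real.log (∏ t ∈ Finset.range A.T, G.mentorPayoff t ω)
      - Real.log (∏ t ∈ Finset.range A.T, G.agentPayoff t ω) : ℝ) : EReal)
  else ⊤

/-- Local generalization with constant `L`. -/
def LocalGeneralization (L : ℝ) : Prop :=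
  ∀ t < A.T, ∀ ω z z', |G.payoff t ω z (m z) - G.payoff t ω z (m z')| ≤ L * dist z z'

/-- The inputs are `σ`-smooth with respect to `U`: given the events of the earlier rounds, each
input has a distribution bounded by `U / σ`. -/
def IsSmooth (U : Measure X) (σ : ℝ) : Prop :=
  ∀ t < A.T, ∀ B : Set X, MeasurableSet B →
    P[(G.input t ⁻¹' B).indicator (fun _ => (1 : ℝ)) | G.before t] ≤ᵐ[P]
      fun _ => 1 / σ * U.real B

end Play

/-- The extended real random variable `R` has a finite expectation, and it is at most `b`. -/
def ExpectationLE {Ω : Type*} [MeasurableSpace Ω] (P : Measure Ω) (R : Ω → EReal) (b : ℝ) : Prop :=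
  (∀ᵐ ω ∂P, R ω ≠ ⊤ ∧ R ω ≠ ⊥) ∧ Integrable (fun ω => (R ω).toReal) P ∧
    ∫ ω, (R ω).toReal ∂P ≤ b

end AskForHelp

end

namespace AskForHelp

/-! The agent loses payoff only in a round without a query in which the policy selected by Hedge
disagrees with the mentor. Some stored input within distance ε^(1/n) then carries the action that is
taken as its mentor action, so local generalization bounds the loss by L ε^(1/n)
(`mentorPayoff_sub_le`). Since ε ≤ (μmin/2L)^n, the agent's payoffs stay above μmin/2, and the loss
in the logarithm is at most 2/μmin times larger (`log_sub_log_le`). Both regrets are thus controlled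
by the expected number M of mistakes of Hedge outside the Hedge queries.

M is of the order (d/σ) T ε log(T + 1/ε). The potential argument for Hedge bounds the excess loss
over the observed rounds. The coins are independent of the adversary's choices, so in expectation a
sum over the observed rounds is p times the full sum (`integral_numMissed_le`). The comparator in
the cover errs with probability at most ε/σ per round in the smooth case and never in the
adversarial case, while the logarithm of the size of the cover is O(d log(T + 1/ε)).

A query is a Hedge query (T p = √(T/ε) in expectation), a mistake, or an unfamiliar input labelled
correctly. Inputs of the last kind with the same label are ε^(1/n)-separated, so comparing volumes
bounds their number by a multiple of 1 + diam^n/ε (`numQueries_le`).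

The adversarial cover comes from an induction on the horizon of Sauer–Shelah type
(`exists_experts`). A maximal ε-separated subset of a VC class is a smooth cover, and its size is
bounded by Haussler's packing argument: the weighted edges of the one-inclusion graph on m + 1
random points are counted in two ways (`mul_sub_le_of_separated`). -/

/-! ### Partial sums of binomial coefficients -/

/-- The number of subsets of size less than `k` of a set of size `m`. -/
def chooseSum (m k : ℕ) : ℕ := ∑ i ∈ Finset.range k, m.choose i

theorem chooseSum_zero_succ (k : ℕ) : chooseSum 0 (k + 1) = 1 := by
  simp [chooseSum, Finset.sum_range_succ']

theorem chooseSum_succ_succ (m k : ℕ) :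
    chooseSum (m + 1) (k + 1) = chooseSum m (k + 1) + chooseSum m k := by
  simp only [chooseSum]
  rw [Finset.sum_range_succ', Finset.sum_range_succ' (fun i => m.choose i)]
  simp only [Nat.choose_succ_succ, Finset.sum_add_distrib, Nat.choose_zero_right,
    Nat.succ_eq_add_one]
  ring

/-- With q = d/m ≤ 1, each term i ≤ d in the expansion of (1 + q)^m carries a factor q^i ≥ q^d, and
(1 + q)^m ≤ e^(qm) = e^d. -/
theorem chooseSum_le {m d : ℕ} (hd : 1 ≤ d) (hdm : d ≤ m) :
    (chooseSum m (d + 1) : ℝ) ≤ (Real.exp 1 * m / d) ^ d := by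
  have hd0 : (0 : ℝ) < d := by exact_mod_cast hd
  have hm0 : (0 : ℝ) < m := by exact_mod_cast hd.trans hdm
  set q : ℝ := d / m with hq
  have hq0 : 0 < q := by positivity
  have hq1 : q ≤ 1 := by
    rw [hq, div_le_one hm0]
    exact_mod_cast hdm
  have h1 : (chooseSum m (d + 1) : ℝ) * q ^ d ≤ (q + 1) ^ m := by
    rw [add_pow, chooseSum, Nat.cast_sum, Finset.sum_mul]
    calc ∑ i ∈ Finset.range (d + 1), (m.choose i : ℝ) * q ^ d
        ≤ ∑ i ∈ Finset.range (d + 1), q ^ i * 1 ^ (m - i) * (m.choose i : ℝ) := by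
          refine Finset.sum_le_sum fun i hi => ?_
          rw [one_pow, mul_one, mul_comm]
          gcongr 1
          exact pow_le_pow_of_le_one hq0.le hq1 (by simpa [Nat.lt_succ_iff] using hi)
      _ ≤ _ := by
          refine Finset.sum_le_sum_of_subset_of_nonneg ?_ fun i _ _ => by positivity
          intro i hi
          simp only [Finset.mem_range] at hi ⊢
          omega
  have h2 : (q + 1) ^ m ≤ Real.exp 1 ^ d := by
    calc (q + 1) ^ m ≤ Real.exp q ^ m := by
          gcongr
          exact Real.add_one_le_exp q
      _ = Real.exp 1 ^ d := by
          rw [← Real.exp_nat_mul, ← Real.exp_nat_mul, hq]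
          congr 1
          field_simp
  have h3 : Real.exp 1 * m / d = Real.exp 1 / q := by
    rw [hq]
    field_simp
  rw [h3, div_pow, le_div_iff₀ (by positivity)]
  exact h1.trans h2

/-! ### Adversarial covers -/

section Littlestone

variable {X : Type*}

theorem ShattersTree.mono {C D : Set (Policy X)} {k : ℕ} (h : ShattersTree C k) (hCD : C ⊆ D) :
    ShattersTree D k := by
  obtain ⟨v, hv⟩ := h
  refine ⟨v, fun b => ?_⟩
  obtain ⟨π, hπ, h⟩ := hv b
  exact ⟨π, hCD hπ, h⟩

theorem ShattersTree.zero [Nonempty X] {C : Set (Policy X)} {π : Policy X} (hπ : π ∈ C) :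
    ShattersTree C 0 :=
  ⟨fun _ => Classical.arbitrary X, fun _ => ⟨π, hπ, fun i => i.elim0⟩⟩

/-- Two shattered trees can be joined at a new root. -/
theorem ShattersTree.succ {C : Set (Policy X)} {k : ℕ} (x : X)
    (h : ∀ b, ShattersTree {π ∈ C | π x = b} k) : ShattersTree C (k + 1) := by
  choose v hv using h
  refine ⟨fun l => match l with
    | [] => x
    | b :: l => v b l, fun b => ?_⟩
  obtain ⟨π, ⟨hπ, hπx⟩, h⟩ := hv (b 0) (fun i => b i.succ)
  refine ⟨π, hπ, fun i => ?_⟩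
  induction i using Fin.cases with
  | zero => simpa using hπx
  | succ i => simpa [List.ofFn_succ] using h i

theorem past_succ (x : ℕ → X) (t : ℕ) : past x (t + 1) = x 0 :: past (fun s => x (s + 1)) t := by
  simp [past, List.range_succ_eq_map, Function.comp_def]

/-- Induction on the horizon. If no tree of depth k + 1 is shattered, each first input x has a label
`b x` such that the policies with this label shatter no tree of depth k; otherwise two trees could
be joined at x. Experts that start with `b x` continue with parameter k, the others with k + 1, and
Pascal's rule adds the two families. For k = 0 the class is empty. -/
theorem exists_experts [Nonempty X] (T : ℕ) : ∀ (k : ℕ) (C : Set (Policy X)), ¬ ShattersTree C k →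
    ∃ f : Fin (chooseSum T k) → Expert X, ∀ π ∈ C, ∀ x : ℕ → X,
      ∃ i, ∀ t < T, f i (past x t) (x t) = π (x t) := by
  induction T with
  | zero =>
    rintro (_ | k) C hC
    · exact ⟨fun _ _ _ => true, fun π hπ => (hC (.zero hπ)).elim⟩
    · refine ⟨fun _ _ _ => true, fun π hπ x => ⟨⟨0, ?_⟩, fun t ht => absurd ht t.not_lt_zero⟩⟩
      simp [chooseSum_zero_succ]
  | succ T ih =>
    rintro (_ | k) C hC
    · exact ⟨fun _ _ _ => true, fun π hπ => (hC (.zero hπ)).elim⟩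
    · have hb : ∀ x : X, ∃ b, ¬ ShattersTree {π ∈ C | π x = b} k := fun x => by
        by_contra! h
        exact hC (.succ x h)
      choose b hb using hb
      choose f hf using fun x => ih (k + 1) C hC
      choose g hg using fun x => ih k _ (hb x)
      -- An empty past means that the current input is the first one. Later the head of the past is
      -- the first input, and it decides which family for the shorter horizon is consulted.
      let F : Fin (chooseSum T (k + 1)) → Expert X := fun i l z => match l with
        | [] => !b z
        | x :: l => f x i l z
      let G : Fin (chooseSum T k) → Expert X := fun i l z => match l with
        | [] => b z
        | x :: l => g x i l z
      refine ⟨fun i => Fin.append F G (Fin.cast (chooseSum_succ_succ T k) i), fun π hπ x => ?_⟩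
      by_cases hx : π (x 0) = b (x 0)
      · obtain ⟨i, hi⟩ := hg (x 0) π ⟨hπ, hx⟩ fun s => x (s + 1)
        refine ⟨Fin.cast (chooseSum_succ_succ T k).symm (Fin.natAdd _ i), fun t ht => ?_⟩
        simp only [Fin.cast_cast, Fin.cast_refl, id_eq, Fin.append_right]
        cases t with
        | zero => simpa [G, past] using hx.symm
        | succ t => simpa [G, past_succ] using hi t (by omega)
      · obtain ⟨i, hi⟩ := hf (x 0) π hπ fun s => x (s + 1)
        refine ⟨Fin.cast (chooseSum_succ_succ T k).symm (Fin.castAdd _ i), fun t ht => ?_⟩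
        simp only [Fin.cast_cast, Fin.cast_refl, id_eq, Fin.append_left]
        cases t with
        | zero =>
          have : (!b (x 0)) = π (x 0) := by
            cases h1 : b (x 0) <;> cases h2 : π (x 0) <;> simp_all
          simpa [F, past] using this
        | succ t => simpa [F, past_succ] using hi t (by omega)

theorem exists_isAdversarialCover {C : Set (Policy X)} {d T : ℕ} (hd : 1 ≤ d)
    (hC : littlestoneDim C = d) (hdT : d ≤ T) :
    ∃ K : Finset (Expert X), IsAdversarialCover T C K ∧
      (K.card : ℝ) ≤ (Real.exp 1 * T / d) ^ d := by
  classical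
  -- Over an empty input space not even a tree of depth 0 exists, so the dimension would be 0.
  have hX : Nonempty X := by
    by_contra hX
    have : littlestoneDim C = 0 := by
      simp only [littlestoneDim, ENat.iSup_eq_zero]
      rintro k ⟨v, -⟩
      exact (hX ⟨v []⟩).elim
    rw [hC] at this
    have : d = 0 := by exact_mod_cast this
    omega
  have hS : ¬ ShattersTree C (d + 1) := fun h => by
    have : ((d + 1 : ℕ) : ℕ∞) ≤ littlestoneDim C := le_iSup₂_of_le (d + 1) h le_rfl
    rw [hC] at this
    have : d + 1 ≤ d := by exact_mod_cast this
    omega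
  obtain ⟨f, hf⟩ := exists_experts T (d + 1) C hS
  refine ⟨Finset.univ.image f, fun π hπ x => ?_, ?_⟩
  · obtain ⟨i, hi⟩ := hf π hπ x
    exact ⟨f i, by simp, hi⟩
  · refine le_trans ?_ (chooseSum_le hd hdT)
    exact_mod_cast Finset.card_image_le.trans (by simp)

end Littlestone

/-! ### Edges of the one-inclusion graph -/

section OneInclusion

theorem sum_eq_sum_insertNth {Z M : Type*} [Fintype Z] [AddCommMonoid M] {m : ℕ} (a : Fin (m + 1))
    (F : (Fin (m + 1) → Z) → M) : ∑ z, F z = ∑ y : Fin m → Z, ∑ x, F (a.insertNth x y) := by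
  classical
  rw [← (Fin.insertNthEquiv (fun _ => Z) a).sum_comp F, Fintype.sum_prod_type, Finset.sum_comm]
  rfl

theorem sum_eq_sum_cons {M : Type*} [AddCommMonoid M] {s : ℕ} (F : (Fin (s + 1) → Bool) → M) :
    ∑ v, F v = ∑ v : Fin s → Bool, (F (Fin.cons false v) + F (Fin.cons true v)) := by
  rw [sum_eq_sum_insertNth 0]
  refine Finset.sum_congr rfl fun v _ => ?_
  simp [Fin.insertNth_zero', add_comm]

/-- The number of pairs of members of `V` that differ in one coordinate only. -/
def edgeCount {s : ℕ} (V : Finset (Fin s → Bool)) : ℕ :=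
  ∑ a, ∑ v, if v a = false ∧ v ∈ V ∧ Function.update v a true ∈ V then 1 else 0

/-- The members of `V` that begin with `b`, with this first coordinate deleted. -/
def slice {s : ℕ} (b : Bool) (V : Finset (Fin (s + 1) → Bool)) : Finset (Fin s → Bool) :=
  Finset.univ.filter fun v => (Fin.cons b v : Fin (s + 1) → Bool) ∈ V

theorem mem_slice {s : ℕ} {b : Bool} {V : Finset (Fin (s + 1) → Bool)} {v : Fin s → Bool} :
    v ∈ slice b V ↔ (Fin.cons b v : Fin (s + 1) → Bool) ∈ V := by
  simp [slice]

theorem card_slice_add {s : ℕ} (V : Finset (Fin (s + 1) → Bool)) :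
    (slice false V).card + (slice true V).card = V.card := by
  simp only [slice, Finset.card_filter, ← Finset.sum_add_distrib]
  rw [← sum_eq_sum_cons fun v => if v ∈ V then 1 else 0]
  simp

/-- An edge in direction 0 is a vector common to both slices; an edge in any other direction stays
inside one slice. -/
theorem edgeCount_eq {s : ℕ} (V : Finset (Fin (s + 1) → Bool)) :
    edgeCount V = (slice false V ∩ slice true V).card
      + (edgeCount (slice false V) + edgeCount (slice true V)) := by
  simp only [edgeCount]
  rw [Fin.sum_univ_succ]
  congr 1
  · rw [sum_eq_sum_cons, ← Finset.filter_univ_mem (slice false V ∩ slice true V),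
      Finset.card_filter]
    simp [Fin.update_cons_zero, mem_slice]
  · rw [← Finset.sum_add_distrib]
    refine Finset.sum_congr rfl fun a _ => ?_
    rw [sum_eq_sum_cons, ← Finset.sum_add_distrib]
    refine Finset.sum_congr rfl fun v _ => ?_
    simp [mem_slice, Fin.cons_update]

/-- Holds edge by edge: an edge inside both sets counts twice on either side, and an edge inside
just one of them lies in the union. -/
theorem edgeCount_add_le {s : ℕ} (V W : Finset (Fin s → Bool)) :
    edgeCount V + edgeCount W ≤ edgeCount (V ∪ W) + edgeCount (V ∩ W) := by
  simp only [edgeCount, ← Finset.sum_add_distrib]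
  refine Finset.sum_le_sum fun a _ => Finset.sum_le_sum fun v _ => ?_
  simp only [Finset.mem_union, Finset.mem_inter]
  split_ifs <;> first | omega | tauto

theorem Shatters.of_slice_union {s : ℕ} {V : Finset (Fin (s + 1) → Bool)} {J : Finset (Fin s)}
    (h : Shatters (slice false V ∪ slice true V : Finset (Fin s → Bool)) J) :
    Shatters (V : Set (Fin (s + 1) → Bool)) (J.map (Fin.succEmb s)) := by
  intro g
  obtain ⟨v, hv, hg⟩ := h fun j => g j.succ
  simp only [Finset.coe_union, Set.mem_union, Finset.mem_coe, mem_slice] at hv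
  rcases hv with hv | hv <;>
  · refine ⟨_, hv, fun x hx => ?_⟩
    obtain ⟨j, hj, rfl⟩ := Finset.mem_map.1 hx
    simpa using hg j hj

theorem Shatters.of_slice_inter {s : ℕ} {V : Finset (Fin (s + 1) → Bool)} {J : Finset (Fin s)}
    (h : Shatters (slice false V ∩ slice true V : Finset (Fin s → Bool)) J) :
    Shatters (V : Set (Fin (s + 1) → Bool))
      (Finset.cons 0 (J.map (Fin.succEmb s)) (by simp [Fin.succ_ne_zero])) := by
  intro g
  obtain ⟨v, hv, hg⟩ := h fun j => g j.succ
  simp only [Finset.coe_inter, Set.mem_inter_iff, Finset.mem_coe, mem_slice] at hv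
  refine ⟨(Fin.cons (g 0) v : Fin (s + 1) → Bool), ?_, fun x hx => ?_⟩
  · cases g 0
    exacts [hv.1, hv.2]
  · rcases Finset.mem_cons.1 hx with rfl | hx
    · simp
    · obtain ⟨j, hj, rfl⟩ := Finset.mem_map.1 hx
      simpa using hg j hj

theorem eq_empty_of_not_shatters {X : Type*} {V : Finset (X → Bool)}
    (h : ∀ J : Finset X, Shatters (V : Set (X → Bool)) J → J.card ≠ 0) : V = ∅ := by
  by_contra hV
  obtain ⟨v, hv⟩ := Finset.nonempty_iff_ne_empty.2 hV
  exact h ∅ (fun _ => ⟨v, hv, by simp⟩) rfl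

/-- The Sauer–Shelah lemma, and the bound on the number of edges of the one-inclusion graph. -/
theorem card_le_and_edgeCount_le (s : ℕ) : ∀ (k : ℕ) (V : Finset (Fin s → Bool)),
    (∀ J : Finset (Fin s), Shatters (V : Set (Fin s → Bool)) J → J.card ≠ k) →
    V.card ≤ chooseSum s k ∧ edgeCount V + V.card ≤ k * V.card := by
  induction s with
  | zero =>
    rintro (_ | k) V hV
    · simp [eq_empty_of_not_shatters hV, edgeCount]
    · refine ⟨?_, by simp [edgeCount, add_mul]⟩
      rw [chooseSum_zero_succ]
      exact Finset.card_le_one_of_subsingleton V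
  | succ s ih =>
    rintro (_ | k) V hV
    · simp [eq_empty_of_not_shatters hV, edgeCount]
    · obtain ⟨h1, h2⟩ := ih (k + 1) (slice false V ∪ slice true V) fun J hJ => by
        simpa using hV _ hJ.of_slice_union
      obtain ⟨h3, h4⟩ := ih k (slice false V ∩ slice true V) fun J hJ => by
        simpa using hV _ hJ.of_slice_inter
      have h5 := card_slice_add V
      have h6 := Finset.card_union_add_card_inter (slice false V) (slice true V)
      have h7 := edgeCount_eq V
      have h8 := edgeCount_add_le (slice false V) (slice true V)
      rw [chooseSum_succ_succ]
      refine ⟨by omega, ?_⟩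
      -- With ∪ and ∩ of the two slices and E the number of edges: E(V) ≤ |∩| + E(∪) + E(∩) ≤ |∩| +
      -- k|∪| + (k - 1)|∩| = k|V|.
      rw [← h5, ← h6]
      nlinarith

theorem min_eq_sum_range {x y M : ℕ} (hx : x ≤ M) :
    min x y = ∑ j ∈ Finset.range M, if j < x ∧ j < y then 1 else 0 := by
  rw [← Finset.card_filter]
  have : (Finset.range M).filter (fun j => j < x ∧ j < y) = Finset.range (min x y) := by
    ext j
    simp only [Finset.mem_filter, Finset.mem_range, lt_min_iff]
    omega
  rw [this, Finset.card_range]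

/-- Layer-cake form of the edge bound: the minimum counts the levels j at which both ends of an edge
lie in {w > j}. Each such superlevel set lies in the support of w, so it shatters no more and has at
most d edges per vertex. -/
theorem sum_min_le {s d : ℕ} (w : (Fin s → Bool) → ℕ)
    (hw : ∀ J : Finset (Fin s), Shatters {v : Fin s → Bool | 0 < w v} J → J.card ≤ d) :
    ∑ a, ∑ v, (if v a = false then min (w v) (w (Function.update v a true)) else 0)
      ≤ d * ∑ v, w v := by
  set M := ∑ v, w v
  have hM : ∀ v, w v ≤ M := fun v =>
    Finset.single_le_sum (f := w) (fun _ _ => Nat.zero_le _) (Finset.mem_univ v)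
  have hV : ∀ j, edgeCount (Finset.univ.filter fun v => j < w v)
      ≤ d * (Finset.univ.filter fun v => j < w v).card := fun j => by
    have := (card_le_and_edgeCount_le s (d + 1) (Finset.univ.filter fun v => j < w v)
      fun J hJ => ?_).2
    · rw [add_mul] at this
      omega
    · have : J.card ≤ d := hw J fun g => by
        obtain ⟨v, hv, h⟩ := hJ g
        refine ⟨v, ?_, h⟩
        have : j < w v := by simpa using hv
        exact (Nat.zero_le j).trans_lt this
      omega
  calc ∑ a, ∑ v, (if v a = false then min (w v) (w (Function.update v a true)) else 0)
      = ∑ j ∈ Finset.range M, edgeCount (Finset.univ.filter fun v => j < w v) := by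
        simp only [edgeCount]
        rw [Finset.sum_comm (s := Finset.range M)]
        refine Finset.sum_congr rfl fun a _ => ?_
        rw [Finset.sum_comm (s := Finset.range M)]
        refine Finset.sum_congr rfl fun v _ => ?_
        rw [min_eq_sum_range (hM v)]
        split_ifs with h <;> simp [h]
    _ ≤ ∑ j ∈ Finset.range M, d * (Finset.univ.filter fun v => j < w v).card :=
        Finset.sum_le_sum fun j _ => hV j
    _ = d * ∑ v, w v := by
        rw [← Finset.mul_sum]
        simp only [Finset.card_filter]
        rw [Finset.sum_comm]
        congr 1
        refine Finset.sum_congr rfl fun v _ => ?_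
        have := min_eq_sum_range (y := w v) (hM v)
        simpa using this.symm

end OneInclusion

/-! ### Haussler's packing bound -/

section Packing

variable {I Z : Type*}

/-- Sum the distances over ordered pairs in S. Separation gives at least ε|S|(|S| - 1). A point x
that splits S into k₀ and k₁ members contributes 2 k₀ k₁ u(x), and k₀ k₁ ≤ |S| min(k₀, k₁). -/
theorem le_sum_min_card [Fintype Z] {f : I → Z → Bool} {u : Z → ℝ} {ε : ℝ} (hu : ∀ z, 0 ≤ u z)
    (hε : ∀ i j, i ≠ j → ε ≤ ∑ z, if f i z = f j z then 0 else u z) {S : Finset I}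
    (hS : S.Nonempty) :
    ε / 2 * (S.card - 1) ≤ ∑ x, u x * (min (S.filter fun i => f i x = false).card
      (S.filter fun i => f i x = true).card : ℕ) := by
  classical
  have hS0 : (0 : ℝ) < S.card := by exact_mod_cast hS.card_pos
  have h1 : ∀ x, ∑ i ∈ S, ∑ j ∈ S, (if f i x = f j x then 0 else u x) ≤
      2 * S.card * (u x * (min (S.filter fun i => f i x = false).card
        (S.filter fun i => f i x = true).card : ℕ)) := fun x => by
    set k₀ := (S.filter fun i => f i x = false).card with hk₀
    set k₁ := (S.filter fun i => f i x = true).card with hk₁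
    have hk : k₁ + k₀ = S.card := by
      rw [hk₀, hk₁, ← Finset.card_filter_add_card_filter_not (s := S) fun i => f i x = true]
      simp
    have hin : ∀ i ∈ S, ∑ j ∈ S, (if f i x = f j x then 0 else u x)
        = if f i x = true then k₀ * u x else k₁ * u x := fun i _ => by
      cases h : f i x
      · rw [hk₁, Finset.card_filter]
        push_cast
        rw [Finset.sum_mul]
        refine Finset.sum_congr rfl fun j _ => ?_
        cases f j x <;> simp
      · rw [hk₀, Finset.card_filter]
        push_cast
        rw [Finset.sum_mul]
        simp only [if_true]
        refine Finset.sum_congr rfl fun j _ => ?_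
        cases f j x <;> simp
    rw [Finset.sum_congr rfl hin, Finset.sum_ite]
    simp only [Finset.sum_const, nsmul_eq_mul, Bool.not_eq_true]
    rw [← hk₀, ← hk₁, ← hk]
    have hmin : k₀ * k₁ ≤ (k₁ + k₀) * min k₀ k₁ := by
      rcases le_total k₀ k₁ with h | h <;> simp only [h, min_eq_left, min_eq_right] <;> nlinarith
    have hmin' : (k₀ : ℝ) * k₁ ≤ (k₁ + k₀) * (min k₀ k₁ : ℕ) := by exact_mod_cast hmin
    push_cast
    push_cast at hmin'
    nlinarith [mul_le_mul_of_nonneg_left hmin' (hu x)]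
  have h2 : S.card * ((S.card - 1) * ε) ≤
      ∑ i ∈ S, ∑ j ∈ S, ∑ x, (if f i x = f j x then 0 else u x) := by
    rw [← nsmul_eq_mul]
    refine Finset.card_nsmul_le_sum _ _ _ fun i hi => ?_
    rw [← Finset.add_sum_erase S _ hi]
    simp only [if_true, Finset.sum_const_zero, zero_add]
    have : ((S.card : ℝ) - 1) = ((S.erase i).card : ℕ) := by
      rw [Finset.card_erase_of_mem hi, Nat.cast_sub hS.card_pos, Nat.cast_one]
    rw [this, ← nsmul_eq_mul]
    exact Finset.card_nsmul_le_sum _ _ _ fun j hj => hε i j (Finset.ne_of_mem_erase hj).symm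
  have h3 : ∑ i ∈ S, ∑ j ∈ S, ∑ x, (if f i x = f j x then 0 else u x)
      = ∑ x, ∑ i ∈ S, ∑ j ∈ S, (if f i x = f j x then 0 else u x) := by
    rw [Finset.sum_comm (s := Finset.univ)]
    refine Finset.sum_congr rfl fun i _ => ?_
    rw [Finset.sum_comm]
  have h4 := h2.trans (h3.trans_le (Finset.sum_le_sum fun x _ => h1 x))
  rw [← Finset.mul_sum] at h4
  have h5 : (S.card : ℝ) * (ε / 2 * (S.card - 1)) ≤ S.card * ∑ x, u x *
      (min (S.filter fun i => f i x = false).card (S.filter fun i => f i x = true).card : ℕ) := by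
    linarith
  exact le_of_mul_le_mul_left h5 hS0

variable [Fintype I]

/-- The number of the functions `f i` with the values `v` at the points `z`. -/
def traceCount (f : I → Z → Bool) {s : ℕ} (z : Fin s → Z) (v : Fin s → Bool) : ℕ :=
  (Finset.univ.filter fun i => (fun j => f i (z j)) = v).card

theorem sum_traceCount (f : I → Z → Bool) {s : ℕ} (z : Fin s → Z) :
    ∑ v, traceCount f z v = Fintype.card I :=
  (Finset.card_eq_sum_card_fiberwise (s := (Finset.univ : Finset I)) (t := Finset.univ)
    (f := fun i j => f i (z j)) (by simp [Set.MapsTo])).symm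

/-- The functions with trace v on y are split by their value at the inserted point. The two ends of
an edge in direction a are therefore the two parts of one class, as `le_sum_min_card` needs. -/
theorem traceCount_insertNth (f : I → Z → Bool) {m : ℕ} (a : Fin (m + 1)) (x : Z) (y : Fin m → Z)
    (b : Bool) (v : Fin m → Bool) :
    traceCount f (a.insertNth x y) (a.insertNth b v) =
      ((Finset.univ.filter fun i => (fun j => f i (y j)) = v).filter fun i => f i x = b).card := by
  rw [traceCount, Finset.filter_filter]
  congr 1
  ext i
  simp only [Finset.mem_filter, Finset.mem_univ, true_and]
  rw [Fin.eq_insertNth_iff, and_comm]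
  have : (a.removeNth fun j => f i ((a.insertNth x y : Fin (m + 1) → Z) j))
      = fun j => f i (y j) := by
    ext j
    simp [Fin.removeNth]
  rw [this]
  simp

theorem card_le_of_shatters_trace (f : I → Z → Bool) {d s : ℕ} (z : Fin s → Z)
    (hf : ∀ J : Finset Z, (∀ x ∈ J, x ∈ Set.range z) → Shatters (Set.range f) J → J.card ≤ d)
    (J : Finset (Fin s)) (hJ : Shatters {v : Fin s → Bool | 0 < traceCount f z v} J) :
    J.card ≤ d := by
  classical
  have key : ∀ g : Fin s → Bool, ∃ i, ∀ j ∈ J, f i (z j) = g j := fun g => by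
    obtain ⟨v, hv, h⟩ := hJ g
    obtain ⟨i, hi⟩ := Finset.card_pos.1 (show 0 < traceCount f z v from hv)
    have hi : (fun j => f i (z j)) = v := by simpa using hi
    refine ⟨i, fun j hj => ?_⟩
    rw [← h j hj, ← hi]
  -- Two coordinates with the same point always receive the same value, so both cannot belong to a
  -- shattered set.
  have hinj : Set.InjOn z J := by
    intro j hj j' hj' hz
    by_contra hne
    obtain ⟨i, hi⟩ := key fun l => decide (l = j)
    have h1 := hi j hj
    have h2 := hi j' hj'
    rw [hz, h2] at h1
    simp [Ne.symm hne] at h1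
  rw [← Finset.card_image_of_injOn hinj]
  refine hf _ (by simp) fun g => ?_
  obtain ⟨i, hi⟩ := key fun j => g (z j)
  exact ⟨f i, ⟨i, rfl⟩, by simpa using hi⟩

variable [Fintype Z]

theorem sum_prod_eq_one {u : Z → ℝ} (hu : ∑ z, u z = 1) (s : ℕ) :
    ∑ z : Fin s → Z, ∏ j, u (z j) = 1 := by
  classical
  have := Finset.prod_univ_sum (fun _ : Fin s => (Finset.univ : Finset Z)) fun _ z => u z
  simpa [hu] using this.symm

/-- Draw m + 1 independent points from u and weight each edge of the one-inclusion graph of the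
traces by the smaller multiplicity of its ends. The total weight is at most d|I| by `sum_min_le`.
For a lower bound in direction a, fix the other m points: by Sauer–Shelah the functions form at most
`chooseSum m (d + 1)` classes, and a class of size k contributes at least (ε/2)(k - 1) on average
over the remaining point. Samples that contain a point of mass 0 do not count, which is why only
shattered sets of positive mass matter. -/
theorem mul_sub_le_of_separated {f : I → Z → Bool} {u : Z → ℝ} {ε : ℝ} {d : ℕ} (m : ℕ)
    (hε0 : 0 ≤ ε) (hu : ∀ z, 0 ≤ u z) (hu1 : ∑ z, u z = 1)
    (hε : ∀ i j, i ≠ j → ε ≤ ∑ z, if f i z = f j z then 0 else u z)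
    (hf : ∀ J : Finset Z, (∀ z ∈ J, 0 < u z) → Shatters (Set.range f) J → J.card ≤ d) :
    (m + 1) * (ε / 2 * (Fintype.card I - chooseSum m (d + 1))) ≤ d * Fintype.card I := by
  classical
  have hp : ∀ {s : ℕ} (z : Fin s → Z), 0 ≤ ∏ j, u (z j) := fun z =>
    Finset.prod_nonneg fun _ _ => hu _
  have hgood : ∀ {s : ℕ} (z : Fin s → Z), ∏ j, u (z j) ≠ 0 → ∀ J : Finset (Fin s),
      Shatters {v : Fin s → Bool | 0 < traceCount f z v} J → J.card ≤ d := fun z hz =>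
    card_le_of_shatters_trace f z fun J hJ => hf J fun x hx => by
      obtain ⟨j, rfl⟩ := hJ x hx
      exact (hu _).lt_of_ne' (Finset.prod_ne_zero_iff.1 hz j (Finset.mem_univ j))
  let E : (Fin (m + 1) → Z) → Fin (m + 1) → ℕ := fun z a => ∑ v, if v a = false then
    min (traceCount f z v) (traceCount f z (Function.update v a true)) else 0
  have hup : ∑ z : Fin (m + 1) → Z, (∏ j, u (z j)) * (∑ a, E z a : ℕ) ≤ d * Fintype.card I := by
    calc ∑ z : Fin (m + 1) → Z, (∏ j, u (z j)) * (∑ a, E z a : ℕ)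
        ≤ ∑ z : Fin (m + 1) → Z, (∏ j, u (z j)) * (d * Fintype.card I : ℕ) := by
          refine Finset.sum_le_sum fun z _ => ?_
          by_cases hz : ∏ j, u (z j) = 0
          · simp [hz]
          · refine mul_le_mul_of_nonneg_left ?_ (hp z)
            have := sum_min_le (traceCount f z) (hgood z hz)
            rw [sum_traceCount] at this
            exact_mod_cast this
      _ = d * Fintype.card I := by
          rw [← Finset.sum_mul, sum_prod_eq_one hu1]
          push_cast
          ring
  have hlow : ∀ a : Fin (m + 1), ε / 2 * (Fintype.card I - chooseSum m (d + 1)) ≤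
      ∑ z : Fin (m + 1) → Z, (∏ j, u (z j)) * (E z a : ℝ) := fun a => by
    rw [sum_eq_sum_insertNth a]
    have hy : ∀ y : Fin m → Z,
        (∏ j, u (y j)) * (ε / 2 * (Fintype.card I - chooseSum m (d + 1))) ≤
        ∑ x, (∏ j, u ((a.insertNth x y : Fin (m + 1) → Z) j)) * (E (a.insertNth x y) a : ℝ) := by
      intro y
      have hE : ∀ x, E (a.insertNth x y) a = ∑ v : Fin m → Bool,
          min ((Finset.univ.filter fun i => (fun j => f i (y j)) = v).filter
            fun i => f i x = false).card
          ((Finset.univ.filter fun i => (fun j => f i (y j)) = v).filter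
            fun i => f i x = true).card := fun x => by
        simp only [E]
        rw [sum_eq_sum_insertNth a]
        refine Finset.sum_congr rfl fun v _ => ?_
        simp only [← traceCount_insertNth f a x y]
        simp
      have hprod : ∀ x, ∏ j, u ((a.insertNth x y : Fin (m + 1) → Z) j)
          = (∏ j, u (y j)) * u x := fun x => by
        rw [Fin.prod_univ_succAbove _ a]
        simp [mul_comm]
      simp only [hprod, mul_assoc, ← Finset.mul_sum]
      by_cases hy0 : ∏ j, u (y j) = 0
      · simp [hy0]
      refine mul_le_mul_of_nonneg_left ?_ (hp y)
      have hV : (Finset.univ.filter fun v => 0 < traceCount f y v).card ≤ chooseSum m (d + 1) := by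
        refine (card_le_and_edgeCount_le m (d + 1) _ fun J hJ => ?_).1
        have : J.card ≤ d := hgood y hy0 J (by simpa using hJ)
        omega
      calc ε / 2 * (Fintype.card I - chooseSum m (d + 1))
          ≤ ε / 2 * (∑ v, (traceCount f y v : ℝ)
              - (Finset.univ.filter fun v => 0 < traceCount f y v).card) := by
            rw [← Nat.cast_sum, sum_traceCount]
            gcongr
        _ = ∑ v, ε / 2 * (traceCount f y v - if 0 < traceCount f y v then 1 else 0) := by
            rw [← Finset.mul_sum, Finset.sum_sub_distrib, Finset.card_filter]
            push_cast
            rfl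
        _ ≤ ∑ v : Fin m → Bool, ∑ x, u x *
            (min ((Finset.univ.filter fun i => (fun j => f i (y j)) = v).filter
              fun i => f i x = false).card
            ((Finset.univ.filter fun i => (fun j => f i (y j)) = v).filter
              fun i => f i x = true).card : ℕ) := by
            refine Finset.sum_le_sum fun v _ => ?_
            split_ifs with hv
            · exact le_sum_min_card hu hε (Finset.card_pos.1 hv)
            · have : traceCount f y v = 0 := by omega
              rw [this]
              simp only [Nat.cast_zero, sub_zero, mul_zero]
              exact Finset.sum_nonneg fun x _ => mul_nonneg (hu x) (Nat.cast_nonneg _)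
        _ = ∑ x, u x * (E (a.insertNth x y) a : ℝ) := by
            rw [Finset.sum_comm]
            refine Finset.sum_congr rfl fun x _ => ?_
            rw [← Finset.mul_sum, hE]
            push_cast
            rfl
    refine le_trans ?_ (Finset.sum_le_sum fun y _ => hy y)
    rw [← Finset.sum_mul, sum_prod_eq_one hu1, one_mul]
  calc (m + 1) * (ε / 2 * (Fintype.card I - chooseSum m (d + 1)))
      = ∑ a : Fin (m + 1), ε / 2 * (Fintype.card I - chooseSum m (d + 1) : ℝ) := by
        simp
    _ ≤ ∑ a : Fin (m + 1), ∑ z : Fin (m + 1) → Z, (∏ j, u (z j)) * (E z a : ℝ) :=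
        Finset.sum_le_sum fun a _ => hlow a
    _ = ∑ z : Fin (m + 1) → Z, (∏ j, u (z j)) * (∑ a, E z a : ℕ) := by
        rw [Finset.sum_comm]
        refine Finset.sum_congr rfl fun z _ => ?_
        push_cast
        rw [Finset.mul_sum]
    _ ≤ _ := hup

/-- Haussler's bound on the size of an `ε`-separated set. -/
theorem card_le_of_separated {f : I → Z → Bool} {u : Z → ℝ} {ε : ℝ} {d : ℕ} (hd : 1 ≤ d)
    (hε0 : 0 < ε) (hε1 : ε ≤ 1) (hu : ∀ z, 0 ≤ u z) (hu1 : ∑ z, u z = 1)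
    (hε : ∀ i j, i ≠ j → ε ≤ ∑ z, if f i z = f j z then 0 else u z)
    (hf : ∀ J : Finset Z, (∀ z ∈ J, 0 < u z) → Shatters (Set.range f) J → J.card ≤ d) :
    (Fintype.card I : ℝ) ≤ (41 / ε) ^ d := by
  have hd0 : (1 : ℝ) ≤ d := by exact_mod_cast hd
  -- This choice makes (m + 1)ε/2 > 2d, so that the double count gives |I| ≤ 2 `chooseSum m (d + 1)`
  -- ≤ 2(4e/ε)^d. The constant 41 leaves room above 8e.
  set m := ⌊4 * d / ε⌋₊ with hm
  have hm1 : (m : ℝ) ≤ 4 * d / ε := Nat.floor_le (by positivity)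
  have hm2 : 4 * d / ε < m + 1 := Nat.lt_floor_add_one _
  have hdm : d ≤ m := Nat.le_floor <| by
    rw [le_div_iff₀ hε0]
    nlinarith
  have h1 := mul_sub_le_of_separated m hε0.le hu hu1 hε hf
  have h2 : (chooseSum m (d + 1) : ℝ) ≤ (4 * Real.exp 1 / ε) ^ d := by
    refine (chooseSum_le hd hdm).trans ?_
    refine pow_le_pow_left₀ (by positivity) ?_ d
    rw [div_le_div_iff₀ (by positivity) hε0]
    rw [le_div_iff₀ hε0] at hm1
    nlinarith [Real.exp_pos 1]
  have h3 : (Fintype.card I : ℝ) ≤ 2 * chooseSum m (d + 1) := by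
    by_contra! h
    have h4 : 4 * d < (m + 1) * ε := (div_lt_iff₀ hε0).1 hm2
    have h5 : (0 : ℝ) < Fintype.card I - chooseSum m (d + 1) := by
      have : (0 : ℝ) ≤ chooseSum m (d + 1) := Nat.cast_nonneg _
      linarith
    nlinarith [mul_lt_mul_of_pos_right h4 h5]
  calc (Fintype.card I : ℝ) ≤ 2 * chooseSum m (d + 1) := h3
    _ ≤ 2 ^ d * (4 * Real.exp 1 / ε) ^ d := by
        gcongr
        exact le_self_pow₀ one_le_two (by omega)
    _ = (2 * (4 * Real.exp 1 / ε)) ^ d := (mul_pow _ _ _).symm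
    _ ≤ (41 / ε) ^ d := by
        gcongr
        rw [mul_div_assoc']
        gcongr
        linarith [Real.exp_one_lt_d9]

end Packing

/-! ### Smooth covers -/

section SmoothCover

variable {X : Type*}

theorem Shatters.card_le {C : Set (Policy X)} {d : ℕ} (hC : vcDim C = d) {s : Finset X}
    (hs : Shatters C s) : s.card ≤ d := by
  have : (s.card : ℕ∞) ≤ vcDim C := le_iSup₂_of_le s hs le_rfl
  rw [hC] at this
  exact_mod_cast this

variable [MeasurableSpace X] {U : Measure X} [IsProbabilityMeasure U]

/-- Joint evaluation pushes U forward to the finite cube of labellings of F, where Haussler's bound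
applies. Points of positive mass in the cube are attained by inputs, so sets of them shattered by
the coordinates lift to sets of inputs shattered by C. -/
theorem card_le_of_separated_policies {C : Set (Policy X)} {d : ℕ} {ε : ℝ} (hd : 1 ≤ d)
    (hε0 : 0 < ε) (hε1 : ε ≤ 1) (hC : vcDim C = d) (hm : ∀ π ∈ C, Measurable π)
    {F : Finset (Policy X)} (hF : ∀ π ∈ F, π ∈ C)
    (hsep : ∀ π ∈ F, ∀ π' ∈ F, π ≠ π' → ε ≤ U.real {x | π x ≠ π' x}) :
    (F.card : ℝ) ≤ (41 / ε) ^ d := by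
  classical
  let Φ : X → F → Bool := fun x i => i.1 x
  have hΦ : Measurable Φ := measurable_pi_lambda _ fun i => hm _ (hF _ i.2)
  let ν := U.map Φ
  have hν : IsProbabilityMeasure ν := Measure.isProbabilityMeasure_map hΦ.aemeasurable
  have hνU : ∀ B : Set (F → Bool), ν.real B = U.real (Φ ⁻¹' B) := fun B =>
    map_measureReal_apply hΦ B.toFinite.measurableSet
  have := card_le_of_separated (I := F) (Z := F → Bool) (f := fun i z => z i)
    (u := fun z => ν.real {z}) hd hε0 hε1 (fun _ => measureReal_nonneg) ?_ ?_ ?_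
  · simpa using this
  · rw [sum_measureReal_singleton]
    simp
  · intro i j hij
    have h1 : ∑ z : F → Bool, (if z i = z j then 0 else ν.real {z})
        = ν.real {z : F → Bool | z i ≠ z j} := by
      have := sum_measureReal_singleton (μ := ν) (Finset.univ.filter fun z : F → Bool => z i ≠ z j)
      rw [Finset.sum_filter] at this
      simp only [ne_eq, ite_not, Finset.coe_filter, Finset.mem_univ, true_and] at this ⊢
      exact this
    rw [h1, hνU]
    exact hsep _ i.2 _ j.2 fun h => hij (Subtype.ext h)
  · intro J hJ hsh
    have hx : ∀ z ∈ J, ∃ x, Φ x = z := fun z hz => by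
      by_contra! h
      have h0 := hJ z hz
      rw [hνU] at h0
      have : Φ ⁻¹' {z} = ∅ := Set.eq_empty_of_forall_notMem fun x hx => h x hx
      simp [this] at h0
    have : Nonempty X := nonempty_of_isProbabilityMeasure U
    choose! x hx using hx
    have hinj : Set.InjOn x J := fun z hz z' hz' h => by rw [← hx z hz, ← hx z' hz', h]
    rw [← Finset.card_image_of_injOn hinj]
    refine Shatters.card_le hC fun g => ?_
    obtain ⟨_, ⟨i, rfl⟩, hi⟩ := hsh fun z => g (x z)
    refine ⟨i.1, hF _ i.2, ?_⟩
    simp only [Finset.mem_image, forall_exists_index, and_imp, forall_apply_eq_imp_iff₂]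
    intro z hz
    rw [← hi z hz]
    exact congrFun (hx z hz) i

variable (U) in
-- A maximal separated set is a cover. If no set within the size bound were a cover, every separated
-- set, being within the bound, could be enlarged by a policy far from all its members, and the
-- packing bound would eventually be violated.
theorem exists_isSmoothCover {C : Set (Policy X)} {d : ℕ} {ε : ℝ} (hd : 1 ≤ d)
    (hm : ∀ π ∈ C, Measurable π) (hC : vcDim C = d) (hε0 : 0 < ε) (hε41 : ε ≤ 41) :
    ∃ K : Finset (Expert X), IsSmoothCover U ε C K ∧ (K.card : ℝ) ≤ (41 / ε) ^ d := by
  classical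
  suffices h : ∃ F : Finset (Policy X), (∀ π ∈ F, π ∈ C) ∧ (F.card : ℝ) ≤ (41 / ε) ^ d ∧
      ∀ π ∈ C, ∃ π' ∈ F, U {x | π x ≠ π' x} ≤ ENNReal.ofReal ε by
    obtain ⟨F, hFC, hF, h⟩ := h
    refine ⟨F.image Policy.toExpert, ⟨fun e he => ?_, fun π hπ => ?_⟩, ?_⟩
    · obtain ⟨π, hπ, rfl⟩ := Finset.mem_image.1 he
      exact ⟨π, hm π (hFC π hπ), rfl⟩
    · obtain ⟨π', hπ', h⟩ := h π hπ
      exact ⟨π', hm π' (hFC π' hπ'), Finset.mem_image_of_mem _ hπ', h⟩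
    · refine le_trans ?_ hF
      exact_mod_cast Finset.card_image_le
  rcases le_or_gt ε 1 with hε1 | hε1
  · by_contra! h
    have hgrow : ∀ k : ℕ, ∃ F : Finset (Policy X), F.card = k ∧ (∀ π ∈ F, π ∈ C) ∧
        ∀ π ∈ F, ∀ π' ∈ F, π ≠ π' → ε ≤ U.real {x | π x ≠ π' x} := by
      intro k
      induction k with
      | zero => exact ⟨∅, by simp⟩
      | succ k ih =>
        obtain ⟨F, hk, hFC, hsep⟩ := ih
        obtain ⟨π, hπ, hfar⟩ := h F hFC
          (card_le_of_separated_policies (U := U) hd hε0 hε1 hC hm hFC hsep)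
        have hfar' : ∀ π' ∈ F, ε ≤ U.real {x | π x ≠ π' x} := fun π' hπ' =>
          (ENNReal.ofReal_le_iff_le_toReal (measure_ne_top _ _)).1 (hfar π' hπ').le
        have hπF : π ∉ F := fun hF => by simpa using hfar π hF
        refine ⟨insert π F, by rw [Finset.card_insert_of_notMem hπF, hk], ?_, ?_⟩
        · simpa [hπ] using hFC
        · intro π₁ h₁ π₂ h₂ hne
          rcases Finset.mem_insert.1 h₁ with e₁ | m₁ <;>
            rcases Finset.mem_insert.1 h₂ with e₂ | m₂
          · exact (hne (e₁.trans e₂.symm)).elim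
          · exact e₁ ▸ hfar' _ m₂
          · rw [e₂]
            simpa only [ne_comm] using hfar' _ m₁
          · exact hsep _ m₁ _ m₂ hne
    obtain ⟨F, hk, hFC, hsep⟩ := hgrow (⌊(41 / ε) ^ d⌋₊ + 1)
    have h1 := card_le_of_separated_policies (U := U) hd hε0 hε1 hC hm hFC hsep
    rw [hk] at h1
    push_cast at h1
    linarith [Nat.lt_floor_add_one ((41 / ε) ^ d)]
  -- For ε > 1 any single policy is a cover, and ε ≤ 41 makes the size bound at least 1.
  · have hne : C.Nonempty := by
      by_contra hne
      have : vcDim C = 0 := by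
        simp only [vcDim, ENat.iSup_eq_zero]
        rintro s hs
        obtain ⟨π, hπ, -⟩ := hs fun _ => true
        exact (hne ⟨π, hπ⟩).elim
      rw [hC] at this
      have : d = 0 := by exact_mod_cast this
      omega
    obtain ⟨π₀, hπ₀⟩ := hne
    refine ⟨{π₀}, by simpa using hπ₀, ?_, fun π _ => ⟨π₀, by simp, ?_⟩⟩
    · simp only [Finset.card_singleton, Nat.cast_one]
      exact one_le_pow₀ ((one_le_div hε0).2 hε41)
    · refine prob_le_one.trans ?_
      rw [ENNReal.one_le_ofReal]
      exact hε1.le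

end SmoothCover

/-! ### Deterministic analysis of a run -/

section Run

variable {X : Type*} {A : Params X} {m : Policy X} {x : ℕ → X}
  {c : ℕ → Bool} {h : ℕ → Expert X}

theorem loss_nonneg (t : ℕ) (e : Expert X) : 0 ≤ loss m x t e := by
  rw [loss]
  split_ifs <;> norm_num

theorem loss_le_one (t : ℕ) (e : Expert X) : loss m x t e ≤ 1 := by
  rw [loss]
  split_ifs <;> norm_num

theorem minLoss_le {t : ℕ} {e : Expert X} (he : e ∈ A.cover) : minLoss A m x t ≤ loss m x t e :=
  ciInf_le (f := fun e : A.cover => loss m x t e) (Finite.bddBelow_range _) ⟨e, he⟩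

theorem minLoss_nonneg (t : ℕ) : 0 ≤ minLoss A m x t :=
  Real.iInf_nonneg fun _ => loss_nonneg t _

variable [PseudoMetricSpace X]

theorem weight_pos (t : ℕ) (e : Expert X) : 0 < (stateAt A m x c h t).weight e := by
  induction t with
  | zero => simp [stateAt]
  | succ t ih =>
    simp only [stateAt]
    split_ifs
    exacts [mul_pos ih (Real.exp_pos _), ih]

theorem hedgeProb_nonneg (t : ℕ) (e : Expert X) : 0 ≤ hedgeProb A (stateAt A m x c h t) e :=
  div_nonneg (weight_pos t e).le (Finset.sum_nonneg fun e _ => (weight_pos t e).le)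

theorem sum_hedgeProb (hA : A.cover.Nonempty) (t : ℕ) :
    ∑ e ∈ A.cover, hedgeProb A (stateAt A m x c h t) e = 1 := by
  simp only [hedgeProb]
  rw [← Finset.sum_div]
  exact div_self (Finset.sum_pos (fun e _ => weight_pos t e) hA).ne'

/-- The mean over the distribution of Hedge of the excess of the loss over the smallest loss. -/
noncomputable def meanExcess (A : Params X) (m : Policy X) (x : ℕ → X) (c : ℕ → Bool) (h : ℕ → Expert X)
    (t : ℕ) : ℝ :=
  ∑ e ∈ A.cover, hedgeProb A (stateAt A m x c h t) e * (loss m x t e - minLoss A m x t)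

theorem meanExcess_nonneg (t : ℕ) : 0 ≤ meanExcess A m x c h t :=
  Finset.sum_nonneg fun e he => mul_nonneg (hedgeProb_nonneg t e) (sub_nonneg.2 (minLoss_le he))

theorem meanExcess_eq (hA : A.cover.Nonempty) (t : ℕ) : meanExcess A m x c h t =
    ∑ e ∈ A.cover, hedgeProb A (stateAt A m x c h t) e * loss m x t e - minLoss A m x t := by
  simp only [meanExcess, mul_sub, Finset.sum_sub_distrib]
  rw [← Finset.sum_mul, sum_hedgeProb hA, one_mul]

theorem meanExcess_le_one (hA : A.cover.Nonempty) (t : ℕ) : meanExcess A m x c h t ≤ 1 := by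
  rw [← sum_hedgeProb (c := c) (h := h) (m := m) (x := x) hA t]
  refine Finset.sum_le_sum fun e _ => mul_le_of_le_one_right (hedgeProb_nonneg t e) ?_
  linarith [loss_le_one (m := m) (x := x) t e, minLoss_nonneg (A := A) (m := m) (x := x) t]

theorem weight_eq (t : ℕ) (e : Expert X) : (stateAt A m x c h t).weight e =
    Real.exp (-(A.η / A.p * ∑ s ∈ Finset.range t,
      if c s = true then loss m x s e - minLoss A m x s else 0)) := by
  induction t with
  | zero => simp [stateAt]
  | succ t ih =>
    simp only [stateAt]
    rw [Finset.sum_range_succ]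
    split_ifs
    · rw [ih, ← Real.exp_add]
      congr 1
      ring
    · rw [ih, add_zero]

/-- Convexity of exp between -u and 0. Unlike a second-order expansion this needs no bound on u, and
the effective rate u = η/p may exceed 1. -/
theorem exp_neg_mul_le {u y : ℝ} (hy0 : 0 ≤ y) (hy1 : y ≤ 1) :
    Real.exp (-(u * y)) ≤ 1 - (1 - Real.exp (-u)) * y := by
  have := convexOn_exp.2 (Set.mem_univ (-u)) (Set.mem_univ 0) hy0 (sub_nonneg.2 hy1)
    (add_sub_cancel y 1)
  simp only [smul_eq_mul, mul_zero, add_zero, Real.exp_zero, mul_one] at this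
  rw [show -(u * y) = y * -u by ring]
  linarith

/-- The potential argument: an observed round multiplies the total weight by at most 1 - (1 -
e^(-u)) `meanExcess`, where u = η/p, and 1 - y ≤ e^(-y). -/
theorem sum_weight_le (hA : A.cover.Nonempty) (t : ℕ) :
    ∑ e ∈ A.cover, (stateAt A m x c h t).weight e ≤ A.cover.card *
      Real.exp (-((1 - Real.exp (-(A.η / A.p))) * ∑ s ∈ Finset.range t,
        if c s = true then meanExcess A m x c h s else 0)) := by
  induction t with
  | zero => simp [stateAt]
  | succ t ih =>
    set u := A.η / A.p with hu
    set W := ∑ e ∈ A.cover, (stateAt A m x c h t).weight e with hW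
    have hW0 : 0 < W := Finset.sum_pos (fun e _ => weight_pos t e) hA
    rw [Finset.sum_range_succ, mul_add, neg_add, Real.exp_add, ← mul_assoc]
    by_cases hc : c t = true
    · have hstep : ∑ e ∈ A.cover, (stateAt A m x c h (t + 1)).weight e
          ≤ W * (1 - (1 - Real.exp (-u)) * meanExcess A m x c h t) := by
        have hR : W * (1 - (1 - Real.exp (-u)) * meanExcess A m x c h t) =
            ∑ e ∈ A.cover, (stateAt A m x c h t).weight e *
              (1 - (1 - Real.exp (-u)) * (loss m x t e - minLoss A m x t)) := by
          simp only [meanExcess, hedgeProb, ← hW, mul_sub, mul_one, Finset.sum_sub_distrib,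
            Finset.mul_sum]
          congr 2
          · refine Finset.sum_congr rfl fun e _ => ?_
            field_simp
          · refine Finset.sum_congr rfl fun e _ => ?_
            field_simp
        rw [hR]
        refine Finset.sum_le_sum fun e he => ?_
        simp only [stateAt, hc, if_true]
        refine mul_le_mul_of_nonneg_left ?_ (weight_pos t e).le
        rw [show -A.η * ((loss m x t e - minLoss A m x t) / A.p)
          = -(u * (loss m x t e - minLoss A m x t)) by rw [hu]; ring]
        refine exp_neg_mul_le (sub_nonneg.2 (minLoss_le he)) ?_
        linarith [loss_le_one (m := m) (x := x) t e, minLoss_nonneg (A := A) (m := m) (x := x) t]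
      refine hstep.trans ?_
      simp only [hc, if_true]
      refine (mul_le_mul_of_nonneg_left ?_ hW0.le).trans
        (mul_le_mul_of_nonneg_right ih (Real.exp_pos _).le)
      linarith [Real.add_one_le_exp (-((1 - Real.exp (-u)) * meanExcess A m x c h t))]
    · simpa [stateAt, hc] using ih

/-- The regret bound of Hedge with the observed rounds only. -/
theorem sum_meanExcess_le {e : Expert X} (he : e ∈ A.cover) (t : ℕ) :
    (1 - Real.exp (-(A.η / A.p))) * ∑ s ∈ Finset.range t,
        (if c s = true then meanExcess A m x c h s else 0) ≤
      Real.log A.cover.card + A.η / A.p * ∑ s ∈ Finset.range t,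
        if c s = true then loss m x s e - minLoss A m x s else 0 := by
  have hA : A.cover.Nonempty := ⟨e, he⟩
  have hN : (0 : ℝ) < A.cover.card := by exact_mod_cast hA.card_pos
  have h1 := (Finset.single_le_sum (fun e _ => (weight_pos (A := A) (m := m) (x := x) (c := c)
    (h := h) t e).le) he).trans (sum_weight_le hA t)
  rw [weight_eq] at h1
  have h2 := Real.log_le_log (Real.exp_pos _) h1
  rw [Real.log_exp, Real.log_mul hN.ne' (Real.exp_ne_zero _), Real.log_exp] at h2
  linarith

/-- Is the input of round `t` stored? -/
def Stored (A : Params X) (m : Policy X) (x : ℕ → X) (c : ℕ → Bool) (h : ℕ → Expert X)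
    (t : ℕ) : Prop :=
  Unfamiliar A (stateAt A m x c h t) (x t) (h t (past x t) (x t)) ∨ (A.storeAll = true ∧ c t = true)

theorem mem_memory {t : ℕ} {q : X × Bool} : q ∈ (stateAt A m x c h t).memory ↔
    ∃ s < t, Stored A m x c h s ∧ q = (x s, m (x s)) := by
  induction t with
  | zero => simp [stateAt]
  | succ t ih =>
    by_cases hs : Stored A m x c h t
    · have hmem : (stateAt A m x c h (t + 1)).memory
          = insert (x t, m (x t)) (stateAt A m x c h t).memory := if_pos hs
      rw [hmem, Set.mem_insert_iff, ih]
      constructor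
      · rintro (rfl | ⟨s, hst, h⟩)
        · exact ⟨t, t.lt_succ_self, hs, rfl⟩
        · exact ⟨s, by omega, h⟩
      · rintro ⟨s, hst, h⟩
        rcases Nat.lt_succ_iff_lt_or_eq.1 hst with hst | rfl
        · exact Or.inr ⟨s, hst, h⟩
        · exact Or.inl h.2
    · have hmem : (stateAt A m x c h (t + 1)).memory = (stateAt A m x c h t).memory := if_neg hs
      rw [hmem, ih]
      constructor
      · rintro ⟨s, hst, h⟩
        exact ⟨s, by omega, h⟩
      · rintro ⟨s, hst, h⟩
        rcases Nat.lt_succ_iff_lt_or_eq.1 hst with hst | rfl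
        · exact ⟨s, hst, h⟩
        · exact (hs h.1).elim

theorem unfamiliar_iff {t : ℕ} {z : X} {y : Bool} :
    Unfamiliar A (stateAt A m x c h t) z y ↔
      ∀ s < t, Stored A m x c h s → m (x s) = y → A.radius < dist z (x s) := by
  simp only [Unfamiliar, mem_memory]
  constructor
  · intro H s hs hst hy
    exact H _ ⟨s, hs, hst, rfl⟩ hy
  · rintro H q ⟨s, hs, hst, rfl⟩ hy
    exact H s hs hst hy

end Run

/-! ### Packing in Euclidean space -/

/-- Balls of radius r/2 about the points are disjoint and lie in a ball of radius D + r/2 about one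
of them; compare volumes. -/
theorem card_le_of_dist_gt {ι : Type*} {n : ℕ} {s : Finset ι} {x : ι → EuclideanSpace ℝ (Fin n)}
    {r D : ℝ} (hr : 0 < r) (hD : 0 ≤ D) (hs : ∀ i ∈ s, ∀ j ∈ s, i ≠ j → r < dist (x i) (x j))
    (hsD : ∀ i ∈ s, ∀ j ∈ s, dist (x i) (x j) ≤ D) : (s.card : ℝ) ≤ (1 + 2 * D / r) ^ n := by
  rcases s.eq_empty_or_nonempty with rfl | ⟨i₀, hi₀⟩
  · simp only [Finset.card_empty, Nat.cast_zero]
    positivity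
  have hdisj : (s : Set ι).PairwiseDisjoint fun i => Metric.ball (x i) (r / 2) :=
    fun i hi j hj hij => Metric.ball_disjoint_ball (by linarith [hs i hi j hj hij])
  have hsub : ⋃ i ∈ s, Metric.ball (x i) (r / 2) ⊆ Metric.ball (x i₀) (D + r / 2) := by
    simp only [Set.iUnion_subset_iff]
    exact fun i hi => Metric.ball_subset_ball' (by linarith [hsD i hi i₀ hi₀])
  have h1 := measure_mono (μ := volume) hsub
  rw [measure_biUnion_finset hdisj fun i _ => measurableSet_ball] at h1
  simp only [Measure.addHaar_ball_of_pos _ _ (half_pos hr),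
    Measure.addHaar_ball_of_pos _ _ (show 0 < D + r / 2 by positivity), Finset.sum_const,
    finrank_euclideanSpace_fin, nsmul_eq_mul, ← mul_assoc] at h1
  rw [ENNReal.mul_le_mul_iff_left (Metric.measure_ball_pos _ _ one_pos).ne' measure_ball_lt_top.ne,
    ← ENNReal.ofReal_natCast, ← ENNReal.ofReal_mul (Nat.cast_nonneg _),
    ENNReal.ofReal_le_ofReal_iff (by positivity)] at h1
  have h2 : 1 + 2 * D / r = (D + r / 2) / (r / 2) := by
    field_simp
    ring
  rw [h2, div_pow, le_div_iff₀ (by positivity)]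
  exact h1

/-! ### The expected number of mistakes -/

/-- How the conditional laws of the coins and draws are used: pull the known factor out of the
conditional expectation and integrate. -/
theorem integral_mul_eq_of_condExp {Ω : Type*} {m₀ mΩ : MeasurableSpace Ω} {P : Measure Ω}
    [IsProbabilityMeasure P] (hm : m₀ ≤ mΩ) {f g h : Ω → ℝ} {C : ℝ} (hf : Measurable[m₀] f)
    (hfC : ∀ ω, |f ω| ≤ C) (hg : Integrable g P) (hh : P[g | m₀] =ᵐ[P] h) :
    ∫ ω, f ω * g ω ∂P = ∫ ω, f ω * h ω ∂P := by
  have hfg : Integrable (f * g) P :=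
    hg.bdd_mul (hf.mono hm le_rfl).aestronglyMeasurable (ae_of_all _ hfC)
  have h1 := condExp_mul_of_stronglyMeasurable_left (m := m₀) (hf.stronglyMeasurable) hfg hg
  calc ∫ ω, f ω * g ω ∂P = ∫ ω, (P[f * g | m₀]) ω ∂P := (integral_condExp hm).symm
    _ = ∫ ω, f ω * h ω ∂P := by
      refine integral_congr_ae ?_
      filter_upwards [h1, hh] with ω h1 h2
      rw [h1, Pi.mul_apply, h2]

namespace Play

variable {X : Type*} [PseudoMetricSpace X] [MeasurableSpace X] {A : Params X} {m : Policy X}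
  {Ω : Type*} [mΩ : MeasurableSpace Ω] {P : Measure Ω} (G : Play A m P)

/-- The sequence of the inputs. -/
abbrev inputs (ω : Ω) : ℕ → X := fun t => G.input t ω

/-- The sequence of the coins. -/
abbrev coins (ω : Ω) : ℕ → Bool := fun t => G.coin t ω

/-- The sequence of the policies selected by Hedge. -/
abbrev draws (ω : Ω) : ℕ → Expert X := fun t => G.draw t ω

/-- The action of the policy selected by Hedge. -/
def guess (t : ℕ) (ω : Ω) : Bool := G.draw t ω (past (G.inputs ω) t) (G.input t ω)

/-- The rounds without a Hedge query in which the policy selected by Hedge errs. -/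
def missed (t : ℕ) : Set Ω := {ω | G.coin t ω = false ∧ G.guess t ω ≠ m (G.input t ω)}

/-- The number of rounds without a Hedge query in which the policy selected by Hedge errs. -/
noncomputable def numMissed (ω : Ω) : ℝ :=
  ∑ t ∈ Finset.range A.T, (G.missed t).indicator (fun _ => (1 : ℝ)) ω

/-! ### Measurability along a play -/

variable {G}

theorem during_le {s t : ℕ} (h : s < t) : G.during s ≤ G.during t :=
  G.during.mono h.le

theorem before_succ_le {s t : ℕ} (h : s < t) : G.before (s + 1) ≤ G.during t :=
  (G.before.mono h).trans (G.before_le_during t)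

theorem measurable_loss {t : ℕ} (ht : t < A.T) {e : Expert X} (he : e ∈ A.cover) :
    Measurable[G.during t] fun ω => loss m (G.inputs ω) t e :=
  Measurable.ite (measurableSet_eq_fun (G.measurable_expert t ht e he) (G.measurable_mentor t ht))
    measurable_const measurable_const

theorem measurable_minLoss {t : ℕ} (ht : t < A.T) :
    Measurable[G.during t] fun ω => minLoss A m (G.inputs ω) t :=
  Measurable.iInf fun e : A.cover => measurable_loss ht e.2

theorem measurable_weight {t : ℕ} (ht : t < A.T) {e : Expert X} (he : e ∈ A.cover) :
    Measurable[G.during t] fun ω =>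
      (stateAt A m (G.inputs ω) (G.coins ω) (G.draws ω) t).weight e := by
  simp only [weight_eq]
  refine Real.measurable_exp.comp (Measurable.neg (Measurable.const_mul ?_ _))
  refine Finset.measurable_sum _ fun s hs => ?_
  have hst := Finset.mem_range.1 hs
  refine Measurable.ite ?_ ?_ measurable_const
  · exact before_succ_le hst _ (G.measurable_coin s (hst.trans ht) (measurableSet_singleton true))
  · exact ((measurable_loss (hst.trans ht) he).sub (measurable_minLoss (hst.trans ht))).mono
      (during_le hst) le_rfl

theorem measurable_hedgeProb {t : ℕ} (ht : t < A.T) {e : Expert X} (he : e ∈ A.cover) :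
    Measurable[G.during t] fun ω =>
      hedgeProb A (stateAt A m (G.inputs ω) (G.coins ω) (G.draws ω) t) e :=
  (measurable_weight ht he).div (Finset.measurable_sum _ fun _ he => measurable_weight ht he)

theorem measurable_meanExcess {t : ℕ} (ht : t < A.T) :
    Measurable[G.during t] fun ω => meanExcess A m (G.inputs ω) (G.coins ω) (G.draws ω) t :=
  Finset.measurable_sum _ fun _ he =>
    (measurable_hedgeProb ht he).mul ((measurable_loss ht he).sub (measurable_minLoss ht))

/-- The space of experts carries no σ-algebra, but the draw takes values in the finite cover, so the
event splits over its members. -/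
theorem measurable_guess {t : ℕ} (ht : t < A.T) : Measurable[G.before (t + 1)] (G.guess t) := by
  refine @measurable_to_countable' _ _ _ _ (G.before (t + 1)) _ fun b => ?_
  have : G.guess t ⁻¹' {b} = ⋃ e ∈ A.cover, {ω | G.draw t ω = e} ∩
      {ω | e (past (G.inputs ω) t) (G.input t ω) = b} := by
    ext ω
    simp only [guess, Set.mem_preimage, Set.mem_singleton_iff, Set.mem_iUnion, Set.mem_inter_iff,
      Set.mem_ofPred_eq, exists_prop]
    constructor
    · intro h
      exact ⟨_, G.draw_mem t ht ω, rfl, h⟩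
    · rintro ⟨e, -, rfl, h⟩
      exact h
  rw [this]
  refine Finset.measurableSet_biUnion _ fun e he => (G.measurable_draw t ht e he).inter ?_
  exact G.during_le_before_succ t _ (G.measurable_expert t ht e he (measurableSet_singleton b))

theorem measurableSet_missed {t : ℕ} (ht : t < A.T) : MeasurableSet (G.missed t) := by
  have h1 : Measurable (G.guess t) := (measurable_guess ht).mono (G.before.le _) le_rfl
  have h2 : Measurable fun ω => m (G.input t ω) :=
    (G.measurable_mentor t ht).mono (G.during.le _) le_rfl
  have h3 : Measurable (G.coin t) := (G.measurable_coin t ht).mono (G.before.le _) le_rfl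
  exact (h3 (measurableSet_singleton false)).inter (measurableSet_eq_fun h1 h2).compl

theorem measurable_numMissed : Measurable G.numMissed :=
  Finset.measurable_sum _ fun _ ht =>
    measurable_const.indicator (measurableSet_missed (Finset.mem_range.1 ht))

theorem measurableSet_coin {t : ℕ} (ht : t < A.T) : MeasurableSet {ω | G.coin t ω = true} :=
  G.before.le _ _ (G.measurable_coin t ht (measurableSet_singleton true))

theorem numMissed_nonneg (ω : Ω) : 0 ≤ G.numMissed ω :=
  Finset.sum_nonneg fun _ _ => Set.indicator_nonneg (fun _ _ => zero_le_one) _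

theorem numMissed_le (ω : Ω) : G.numMissed ω ≤ A.T := by
  refine (Finset.sum_le_card_nsmul _ _ 1 fun t _ => ?_).trans (by simp)
  exact Set.indicator_le_self' (fun _ _ => zero_le_one) ω

variable [IsProbabilityMeasure P]

theorem integrable_numMissed : Integrable G.numMissed P :=
  Integrable.of_bound measurable_numMissed.aestronglyMeasurable A.T <| ae_of_all _ fun ω => by
    rw [Real.norm_of_nonneg (numMissed_nonneg ω)]
    exact numMissed_le ω

theorem integral_coin_mul {t : ℕ} (ht : t < A.T) {Y : Ω → ℝ} {C : ℝ} (hY : Measurable[G.during t] Y)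
    (hC : ∀ ω, |Y ω| ≤ C) :
    ∫ ω, (if G.coin t ω = true then Y ω else 0) ∂P = A.p * ∫ ω, Y ω ∂P := by
  have := integral_mul_eq_of_condExp (G.during.le t) hY hC
    ((integrable_const (1 : ℝ)).indicator (measurableSet_coin ht)) (G.coin_law t ht)
  rw [integral_mul_const, mul_comm] at this
  rw [← this]
  refine integral_congr_ae (ae_of_all _ fun ω => ?_)
  by_cases h : G.coin t ω = true <;> simp [h]

theorem integrable_of_mem_Icc {Y : Ω → ℝ} (hY : Measurable Y) (h0 : ∀ ω, 0 ≤ Y ω)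
    (h1 : ∀ ω, Y ω ≤ 1) : Integrable Y P :=
  Integrable.of_bound hY.aestronglyMeasurable 1 <| ae_of_all _ fun ω => by
    rw [Real.norm_of_nonneg (h0 ω)]
    exact h1 ω

theorem integrable_coin_mul {t : ℕ} (ht : t < A.T) {Y : Ω → ℝ} (hY : Measurable Y)
    (h0 : ∀ ω, 0 ≤ Y ω) (h1 : ∀ ω, Y ω ≤ 1) :
    Integrable (fun ω => if G.coin t ω = true then Y ω else 0) P :=
  integrable_of_mem_Icc (Measurable.ite (measurableSet_coin ht) hY measurable_const)
    (fun ω => by split_ifs; exacts [h0 ω, le_rfl])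
    (fun ω => by split_ifs; exacts [h1 ω, zero_le_one])

/-- A miss is the sum over e of the loss of e times the indicator that there is no Hedge query and e
is drawn. The loss is known before the draw, so the indicator may be replaced by its conditional
probability. -/
theorem integral_missed {t : ℕ} (ht : t < A.T) :
    ∫ ω, (G.missed t).indicator (fun _ => (1 : ℝ)) ω ∂P = (1 - A.p) * ∫ ω, ∑ e ∈ A.cover,
      hedgeProb A (stateAt A m (G.inputs ω) (G.coins ω) (G.draws ω) t) e *
        loss m (G.inputs ω) t e ∂P := by
  have hmiss : ∀ ω, (G.missed t).indicator (fun _ => (1 : ℝ)) ω = ∑ e ∈ A.cover,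
      loss m (G.inputs ω) t e *
        {ω | G.coin t ω = false ∧ G.draw t ω = e}.indicator (fun _ => (1 : ℝ)) ω := by
    intro ω
    rw [Finset.sum_eq_single (G.draw t ω)]
    · by_cases hc : G.coin t ω = false <;>
        by_cases hg : G.draw t ω (past (G.inputs ω) t) (G.input t ω) = m (G.input t ω) <;>
        simp [missed, guess, loss, hc, hg, Set.indicator]
    · intro e _ hne
      simp [Ne.symm hne]
    · exact fun h => (h (G.draw_mem t ht ω)).elim
  have hset : ∀ e ∈ A.cover, MeasurableSet {ω | G.coin t ω = false ∧ G.draw t ω = e} :=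
    fun e he => G.before.le _ _
      ((G.measurable_coin t ht (measurableSet_singleton false)).inter (G.measurable_draw t ht e he))
  have habs : ∀ e ω, |loss m (G.inputs ω) t e| ≤ 1 := fun e ω => by
    rw [abs_of_nonneg (loss_nonneg t e)]
    exact loss_le_one t e
  simp only [hmiss]
  rw [integral_finsetSum, integral_finsetSum, Finset.mul_sum]
  · refine Finset.sum_congr rfl fun e he => ?_
    rw [integral_mul_eq_of_condExp (G.during.le t) (measurable_loss ht he) (habs e)
      ((integrable_const (1 : ℝ)).indicator (hset e he)) (G.draw_law t ht e he),
      ← integral_const_mul]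
    refine integral_congr_ae (ae_of_all _ fun ω => ?_)
    simp only
    ring
  · intro e he
    refine integrable_of_mem_Icc (((measurable_hedgeProb ht he).mul (measurable_loss ht he)).mono
      (G.during.le t) le_rfl) (fun ω => mul_nonneg (hedgeProb_nonneg t e) (loss_nonneg t e))
      fun ω => mul_le_one₀ ?_ (loss_nonneg t e) (loss_le_one t e)
    rw [← sum_hedgeProb ⟨e, he⟩ t]
    exact Finset.single_le_sum (fun e _ => hedgeProb_nonneg t e) he
  · intro e he
    exact ((integrable_const (1 : ℝ)).indicator (hset e he)).bdd_mul
      ((measurable_loss ht he).mono (G.during.le t) le_rfl).aestronglyMeasurable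
      (ae_of_all _ (habs e))

/-- If in each run some member of the cover errs in round `t` with probability at most `δ`, then
Hedge, though it sees only a fraction `p` of the losses, makes few mistakes. -/
theorem integral_numMissed_le {Y : ℕ → Ω → ℝ} {δ : ℝ} (hp0 : 0 < A.p) (hη : 0 < A.η)
    (hYm : ∀ t < A.T, Measurable[G.during t] (Y t)) (hY0 : ∀ t ω, 0 ≤ Y t ω)
    (hY1 : ∀ t ω, Y t ω ≤ 1)
    (hY : ∀ ω, ∃ e ∈ A.cover, ∀ t < A.T, loss m (G.inputs ω) t e ≤ Y t ω)
    (hδ : ∀ t < A.T, ∫ ω, Y t ω ∂P ≤ δ) :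
    ∫ ω, G.numMissed ω ∂P ≤ (Real.log A.cover.card + A.η * (A.T * δ)) /
      (A.p * (1 - Real.exp (-(A.η / A.p)))) + A.T * δ := by
  set u := A.η / A.p with hu
  have hu0 : 0 < u := div_pos hη hp0
  have hu1 : 0 < 1 - Real.exp (-u) := by
    rw [sub_pos, Real.exp_lt_one_iff]
    linarith
  obtain ⟨ω₀⟩ : Nonempty Ω := nonempty_of_isProbabilityMeasure P
  have hA : A.cover.Nonempty := let ⟨e, he, _⟩ := hY ω₀; ⟨e, he⟩
  have hEm : ∀ t < A.T,
      Measurable[G.during t] fun ω => meanExcess A m (G.inputs ω) (G.coins ω) (G.draws ω) t :=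
    fun t ht => measurable_meanExcess ht
  have hEi : ∀ t < A.T,
      Integrable (fun ω => meanExcess A m (G.inputs ω) (G.coins ω) (G.draws ω) t) P :=
    fun t ht => integrable_of_mem_Icc ((hEm t ht).mono (G.during.le t) le_rfl)
      (fun ω => meanExcess_nonneg t) fun ω => meanExcess_le_one hA t
  have hYm' : ∀ t < A.T, Measurable (Y t) := fun t ht => (hYm t ht).mono (G.during.le t) le_rfl
  have hYi : ∀ t < A.T, Integrable (Y t) P := fun t ht =>
    integrable_of_mem_Icc (hYm' t ht) (hY0 t) (hY1 t)
  have hcEi : ∀ t ∈ Finset.range A.T, Integrable (fun ω => if G.coin t ω = true then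
      meanExcess A m (G.inputs ω) (G.coins ω) (G.draws ω) t else 0) P := fun t ht =>
    integrable_coin_mul (Finset.mem_range.1 ht)
      ((hEm t (Finset.mem_range.1 ht)).mono (G.during.le t) le_rfl)
      (fun ω => meanExcess_nonneg t) fun ω => meanExcess_le_one hA t
  have hcYi : ∀ t ∈ Finset.range A.T,
      Integrable (fun ω => if G.coin t ω = true then Y t ω else 0) P := fun t ht =>
    integrable_coin_mul (Finset.mem_range.1 ht) (hYm' t (Finset.mem_range.1 ht)) (hY0 t) (hY1 t)
  have hmin : ∀ t < A.T, ∀ ω, minLoss A m (G.inputs ω) t ≤ Y t ω := fun t ht ω => by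
    obtain ⟨e, he, h⟩ := hY ω
    exact (minLoss_le he).trans (h t ht)
  -- The comparator may depend on the whole run. Its loss is replaced by the bound Y before
  -- integrating, because Y is known before the coin of the round is tossed.
  have hpath : ∀ ω, (1 - Real.exp (-u)) * ∑ t ∈ Finset.range A.T, (if G.coin t ω = true then
      meanExcess A m (G.inputs ω) (G.coins ω) (G.draws ω) t else 0) ≤
      Real.log A.cover.card + u * ∑ t ∈ Finset.range A.T,
        if G.coin t ω = true then Y t ω else 0 := fun ω => by
    obtain ⟨e, he, h⟩ := hY ω
    refine (sum_meanExcess_le he A.T).trans ?_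
    gcongr with t ht
    split_ifs
    · linarith [h t (Finset.mem_range.1 ht), minLoss_nonneg (A := A) (m := m) (x := G.inputs ω) t]
    · exact le_rfl
  have hint := integral_mono ((integrable_finsetSum _ hcEi).const_mul (1 - Real.exp (-u)))
    ((integrable_const _).add ((integrable_finsetSum _ hcYi).const_mul u)) hpath
  rw [integral_const_mul, integral_finsetSum _ hcEi, integral_add' (integrable_const _)
    ((integrable_finsetSum _ hcYi).const_mul u), integral_const_mul, integral_finsetSum _ hcYi]
    at hint
  simp only [integral_const, probReal_univ, one_smul] at hint
  have e1 : ∀ t ∈ Finset.range A.T, ∫ ω, (if G.coin t ω = true then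
      meanExcess A m (G.inputs ω) (G.coins ω) (G.draws ω) t else 0) ∂P =
      A.p * ∫ ω, meanExcess A m (G.inputs ω) (G.coins ω) (G.draws ω) t ∂P := fun t ht =>
    integral_coin_mul (C := 1) (Finset.mem_range.1 ht) (hEm t (Finset.mem_range.1 ht)) fun ω => by
      rw [abs_of_nonneg (meanExcess_nonneg t)]
      exact meanExcess_le_one hA t
  have e2 : ∀ t ∈ Finset.range A.T,
      ∫ ω, (if G.coin t ω = true then Y t ω else 0) ∂P ≤ A.p * δ := fun t ht => by
    rw [integral_coin_mul (C := 1) (Finset.mem_range.1 ht) (hYm t (Finset.mem_range.1 ht)) fun ω =>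
      by rw [abs_of_nonneg (hY0 t ω)]; exact hY1 t ω]
    exact mul_le_mul_of_nonneg_left (hδ t (Finset.mem_range.1 ht)) hp0.le
  rw [Finset.sum_congr rfl e1, ← Finset.mul_sum] at hint
  have e3 := Finset.sum_le_sum e2
  rw [Finset.sum_const, Finset.card_range, nsmul_eq_mul] at e3
  have hmain : ∑ t ∈ Finset.range A.T,
      ∫ ω, meanExcess A m (G.inputs ω) (G.coins ω) (G.draws ω) t ∂P ≤
      (Real.log A.cover.card + A.η * (A.T * δ)) / (A.p * (1 - Real.exp (-u))) := by
    rw [le_div_iff₀ (mul_pos hp0 hu1)]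
    have e4 := mul_le_mul_of_nonneg_left e3 hu0.le
    have e5 : u * (A.T * (A.p * δ)) = A.η * (A.T * δ) := by
      rw [hu]
      field_simp
    linarith
  -- The mean loss of Hedge is the mean excess plus the smallest loss, and the latter is at most Y;
  -- the factor 1 - p is dropped.
  have hstep : ∀ t ∈ Finset.range A.T, ∫ ω, (G.missed t).indicator (fun _ => (1 : ℝ)) ω ∂P ≤
      ∫ ω, meanExcess A m (G.inputs ω) (G.coins ω) (G.draws ω) t ∂P + δ := fun t ht => by
    have ht' := Finset.mem_range.1 ht
    rw [integral_missed ht']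
    have hle : ∀ ω, ∑ e ∈ A.cover,
        hedgeProb A (stateAt A m (G.inputs ω) (G.coins ω) (G.draws ω) t) e *
        loss m (G.inputs ω) t e ≤
        meanExcess A m (G.inputs ω) (G.coins ω) (G.draws ω) t + Y t ω := fun ω => by
      rw [meanExcess_eq hA]
      linarith [hmin t ht' ω]
    have hnn : ∀ ω, 0 ≤ ∑ e ∈ A.cover,
        hedgeProb A (stateAt A m (G.inputs ω) (G.coins ω) (G.draws ω) t) e *
        loss m (G.inputs ω) t e := fun ω =>
      Finset.sum_nonneg fun e _ => mul_nonneg (hedgeProb_nonneg t e) (loss_nonneg t e)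
    refine (mul_le_of_le_one_left (integral_nonneg hnn) (by linarith)).trans ?_
    refine (integral_mono_of_nonneg (ae_of_all _ hnn) ((hEi t ht').add (hYi t ht'))
      (ae_of_all _ hle)).trans ?_
    rw [integral_add' (hEi t ht') (hYi t ht')]
    linarith [hδ t ht']
  simp only [numMissed]
  rw [integral_finsetSum _ fun t ht => (integrable_const (1 : ℝ)).indicator
    (measurableSet_missed (Finset.mem_range.1 ht))]
  refine (Finset.sum_le_sum hstep).trans ?_
  rw [Finset.sum_add_distrib, Finset.sum_const, Finset.card_range, nsmul_eq_mul]
  linarith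

end Play

/-! ### Numerical estimates -/

theorem half_le_log_two : 1 / 2 ≤ Real.log 2 := by
  linarith [Real.log_two_gt_d9]

theorem log_two_le_log_add {T ε : ℝ} (hT : 1 ≤ T) (hε0 : 0 < ε) (hε1 : ε ≤ 1) :
    Real.log 2 ≤ Real.log (T + 1 / ε) := by
  have : 1 ≤ 1 / ε := (one_le_div hε0).2 hε1
  exact Real.log_le_log two_pos (by linarith)

theorem log_add_nonneg {T ε : ℝ} (hT : 1 ≤ T) (hε0 : 0 < ε) : 0 ≤ Real.log (T + 1 / ε) :=
  Real.log_nonneg (by linarith [one_div_pos.2 hε0])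

/-- Lets additive constants be absorbed into the main term. For ε ≤ 1 use Tε ≥ 1 and log 2 ≥ 1/2;
for ε ≥ 1 use log(1 + 1/ε) ≥ 1/(ε + 1). -/
theorem half_le_mul_log {T ε : ℝ} (hT : 1 ≤ T) (hε : 1 / T ≤ ε) :
    1 / 2 ≤ T * ε * Real.log (T + 1 / ε) := by
  have hT0 : 0 < T := by linarith
  have hε0 : 0 < ε := (one_div_pos.2 hT0).trans_le hε
  rcases le_total ε 1 with h | h
  · have h1 : 1 ≤ T * ε := by
      rw [div_le_iff₀ hT0] at hε
      linarith
    calc 1 / 2 ≤ Real.log (T + 1 / ε) := half_le_log_two.trans (log_two_le_log_add hT hε0 h)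
      _ ≤ _ := le_mul_of_one_le_left (log_add_nonneg hT hε0) h1
  · have h1 : 1 / (ε + 1) ≤ Real.log (T + 1 / ε) := by
      have h2 : 0 < 1 + 1 / ε := by positivity
      calc 1 / (ε + 1) = 1 - (1 + 1 / ε)⁻¹ := by
            field_simp
            ring
        _ ≤ Real.log (1 + 1 / ε) := Real.one_sub_inv_le_log_of_pos h2
        _ ≤ Real.log (T + 1 / ε) := Real.log_le_log h2 (by linarith)
    calc 1 / 2 ≤ ε * (1 / (ε + 1)) := by
          rw [mul_one_div, div_le_div_iff₀ two_pos (by linarith)]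
          linarith
      _ ≤ ε * Real.log (T + 1 / ε) := by gcongr
      _ ≤ T * (ε * Real.log (T + 1 / ε)) :=
          le_mul_of_one_le_left (mul_nonneg hε0.le (log_add_nonneg hT hε0)) hT
      _ = _ := by ring

theorem log_le_of_le_smooth {N T ε : ℝ} {d : ℕ} (hN : 0 < N) (hT : 1 ≤ T) (hε0 : 0 < ε)
    (hε1 : ε ≤ 1) (h : N ≤ (41 / ε) ^ d) : Real.log N ≤ 7 * d * Real.log (T + 1 / ε) := by
  have h1 : Real.log N ≤ d * (Real.log 41 + Real.log (1 / ε)) := by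
    refine (Real.log_le_log hN h).trans_eq ?_
    rw [Real.log_pow, ← Real.log_mul (by norm_num) (by positivity), mul_one_div]
  -- From 41 ≤ 2^6. These six copies of the logarithm and one for log(1/ε) make the constant 7.
  have h2 : Real.log 41 ≤ 6 * Real.log 2 := by
    have : (6 : ℝ) * Real.log 2 = Real.log (2 ^ 6) := by
      rw [Real.log_pow]
      norm_num
    rw [this]
    exact Real.log_le_log (by norm_num) (by norm_num)
  have h3 := log_two_le_log_add hT hε0 hε1
  have h4 : Real.log (1 / ε) ≤ Real.log (T + 1 / ε) :=
    Real.log_le_log (by positivity) (by linarith)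
  calc Real.log N ≤ d * (Real.log 41 + Real.log (1 / ε)) := h1
    _ ≤ d * (7 * Real.log (T + 1 / ε)) := by
        gcongr
        linarith
    _ = _ := by ring

theorem log_le_of_le_adversarial {N T ε : ℝ} {d : ℕ} (hd : 1 ≤ d) (hN : 0 < N) (hT : 1 ≤ T)
    (hε0 : 0 < ε) (hε1 : ε ≤ 1) (h : N ≤ (Real.exp 1 * T / d) ^ d) :
    Real.log N ≤ 7 * d * Real.log (T + 1 / ε) := by
  have hT0 : 0 < T := by linarith
  have hd1 : (1 : ℝ) ≤ d := by exact_mod_cast hd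
  have h1 : Real.log N ≤ d * (1 + Real.log T) := by
    refine (Real.log_le_log hN h).trans ?_
    rw [Real.log_pow]
    have h2 : Real.log (Real.exp 1 * T / d) ≤ Real.log (Real.exp 1 * T) :=
      Real.log_le_log (by positivity) (div_le_self (by positivity) hd1)
    rw [Real.log_mul (Real.exp_ne_zero 1) hT0.ne', Real.log_exp] at h2
    gcongr
  have h3 := log_two_le_log_add hT hε0 hε1
  have h4 : Real.log T ≤ Real.log (T + 1 / ε) :=
    Real.log_le_log hT0 (by linarith [one_div_pos.2 hε0])
  calc Real.log N ≤ d * (1 + Real.log T) := h1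
    _ ≤ d * (7 * Real.log (T + 1 / ε)) := by
        gcongr
        linarith [half_le_log_two]
    _ = _ := by ring

/-- With u = η/p, e^(-u) ≤ 1/(1 + u) bounds the denominator below by η/(1 + u), valid for every u >
0; the rest is expansion. -/
theorem div_mul_one_sub_exp_le {p η l D : ℝ} (hp : 0 < p) (hη : 0 < η) (hl : 0 ≤ l) (hD : 0 ≤ D) :
    (l + η * D) / (p * (1 - Real.exp (-(η / p)))) ≤ l / η + l / p + D + D * (η / p) := by
  set u := η / p with hu
  have hu0 : 0 < u := div_pos hη hp
  have h1 : Real.exp (-u) ≤ 1 / (1 + u) := by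
    rw [Real.exp_neg, ← one_div]
    exact one_div_le_one_div_of_le (by linarith) (by linarith [Real.add_one_le_exp u])
  have h2 : η / (1 + u) ≤ p * (1 - Real.exp (-u)) := by
    calc η / (1 + u) = p * (1 - 1 / (1 + u)) := by
          have : η = p * u := by
            rw [hu]
            field_simp
          rw [this]
          field_simp
          ring
      _ ≤ _ := by gcongr
  calc (l + η * D) / (p * (1 - Real.exp (-u))) ≤ (l + η * D) / (η / (1 + u)) := by
        gcongr
    _ = l / η + l / p + D + D * (η / p) := by
        rw [hu]
        field_simp
        ring

/-! ### The query probability, the learning rate and the radius -/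

namespace Params

variable {X : Type*} {A : Params X}

theorem p_pos (hT : 1 ≤ A.T) (hε : 0 < A.ε) : 0 < A.p := by
  have : (0 : ℝ) < A.T := by exact_mod_cast hT
  exact one_div_pos.2 (Real.sqrt_pos.2 (mul_pos hε this))

theorem p_sq (hT : 1 ≤ A.T) (hε : 0 < A.ε) : A.p ^ 2 = 1 / (A.ε * A.T) := by
  have : (0 : ℝ) < A.T := by exact_mod_cast hT
  rw [p, div_pow, Real.sq_sqrt (by positivity), one_pow]

theorem one_le_mul (hT : 1 ≤ A.T) (hε : 1 / A.T ≤ A.ε) : 1 ≤ A.ε * A.T := by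
  have : (0 : ℝ) < A.T := by exact_mod_cast hT
  exact (div_le_iff₀ this).1 hε

theorem pos_of_le (hT : 1 ≤ A.T) (hε : 1 / A.T ≤ A.ε) : 0 < A.ε := by
  have : (0 : ℝ) < A.T := by exact_mod_cast hT
  exact (one_div_pos.2 this).trans_le hε

theorem p_le_one (hT : 1 ≤ A.T) (hε : 1 / A.T ≤ A.ε) : A.p ≤ 1 := by
  have h := one_le_mul hT hε
  rw [p, div_le_one (Real.sqrt_pos.2 (by linarith))]
  exact Real.one_le_sqrt.2 h

theorem mul_p_eq (hT : 1 ≤ A.T) (hε : 0 < A.ε) : A.T * A.p = √(A.T / A.ε) := by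
  have hT0 : (0 : ℝ) < A.T := by exact_mod_cast hT
  rw [← Real.sqrt_sq (mul_pos hT0 (p_pos hT hε)).le, mul_pow, p_sq hT hε]
  congr 1
  field_simp

theorem η_pos (hT : 1 ≤ A.T) (hε : 0 < A.ε) : 0 < A.η :=
  lt_max_of_lt_right (div_pos (pow_pos (p_pos hT hε) 2) (by positivity))

/-- The rate η/p need not be small, but it is at most 1 + log of the size of the cover. For the
first term of the maximum this uses T p = √(T/ε) ≥ 1. -/
theorem η_le (hT : 1 ≤ A.T) (hε : 1 / A.T ≤ A.ε) (hε1 : A.ε ≤ 1) :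
    A.η ≤ A.p * (1 + Real.log A.cover.card) := by
  have hT1 : (1 : ℝ) ≤ A.T := by exact_mod_cast hT
  have hε0 := pos_of_le hT hε
  have hp0 := p_pos hT hε0
  have hp1 := p_le_one hT hε
  set l := Real.log A.cover.card with hl
  have hl0 : 0 ≤ l := Real.log_natCast_nonneg _
  refine max_le ?_ ?_
  · refine Real.sqrt_le_iff.2 ⟨by positivity, ?_⟩
    have h1 : 1 ≤ A.T * A.p := by
      rw [mul_p_eq hT hε0, Real.one_le_sqrt, one_le_div hε0]
      linarith
    rw [div_le_iff₀ (by positivity)]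
    calc A.p * l ≤ A.p * ((1 + l) ^ 2 * 2) := by
          gcongr
          nlinarith
      _ ≤ (A.p * ((1 + l) ^ 2 * 2)) * (A.T * A.p) :=
          le_mul_of_one_le_right (by positivity) h1
      _ = _ := by ring
  · calc A.p ^ 2 / √2 ≤ A.p ^ 2 := div_le_self (by positivity) (Real.one_le_sqrt.2 one_le_two)
      _ ≤ A.p := by nlinarith
      _ ≤ _ := le_mul_of_one_le_right hp0.le (by linarith)

theorem hedge_bound_le {d : ℕ} {σ : ℝ} (hT : 1 ≤ A.T) (hε : 1 / A.T ≤ A.ε) (hε1 : A.ε ≤ 1)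
    (hd : 1 ≤ d) (hσ0 : 0 < σ) (hσ1 : σ ≤ 1)
    (hl : Real.log A.cover.card ≤ 7 * d * Real.log (A.T + 1 / A.ε)) :
    (Real.log A.cover.card + A.η * (A.T * (A.ε / σ))) /
      (A.p * (1 - Real.exp (-(A.η / A.p)))) + A.T * (A.ε / σ) ≤
    33 * (d / σ * A.T * A.ε * Real.log (A.T + 1 / A.ε)) := by
  have hT1 : (1 : ℝ) ≤ A.T := by exact_mod_cast hT
  have hd1 : (1 : ℝ) ≤ d := by exact_mod_cast hd
  have hε0 := pos_of_le hT hε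
  have hp0 := p_pos hT hε0
  have hη0 := η_pos hT hε0
  have hΛ := half_le_log_two.trans (log_two_le_log_add hT1 hε0 hε1)
  set Λ := Real.log (A.T + 1 / A.ε)
  set l := Real.log A.cover.card with hl_def
  have hl0 : 0 ≤ l := Real.log_natCast_nonneg _
  set D := A.T * (A.ε / σ) with hD
  have hD0 : 0 ≤ D := by positivity
  have h1 : A.ε * A.T ≤ D := by
    rw [hD, mul_comm, mul_div_assoc']
    exact le_div_self (by positivity) hσ0 hσ1
  -- The floor p²/√2 in the learning rate serves here: 1/p² = εT ≤ D and √2 ≤ 3/2.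
  have h2 : l / A.η ≤ 3 / 2 * (l * D) := by
    have h3 : A.p ^ 2 * (2 / 3) ≤ A.η := by
      refine le_trans ?_ (le_max_right _ _)
      rw [div_eq_mul_inv (A.p ^ 2)]
      gcongr
      rw [← one_div, le_one_div (by norm_num) (by positivity)]
      refine Real.sqrt_le_iff.2 (by norm_num)
    rw [div_le_iff₀ hη0]
    have h4 : A.p ^ 2 * (A.ε * A.T) = 1 := by
      rw [p_sq hT hε0]
      field_simp
    calc l = 3 / 2 * (l * (A.ε * A.T)) * (A.p ^ 2 * (2 / 3)) := by linear_combination -l * h4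
      _ ≤ 3 / 2 * (l * D) * A.η := by gcongr
  have h3 : l / A.p ≤ l * D := by
    rw [p, div_div_eq_mul_div, div_one]
    gcongr
    refine (Real.sqrt_le_iff.2 ⟨by positivity, ?_⟩).trans h1
    nlinarith [one_le_mul hT hε]
  have h4 : D * (A.η / A.p) ≤ D * (1 + l) := by
    gcongr
    rw [div_le_iff₀ hp0, mul_comm]
    exact η_le hT hε hε1
  have h5 := div_mul_one_sub_exp_le hp0 hη0 hl0 hD0
  have h6 : 33 * (d / σ * A.T * A.ε * Λ) = D * (33 * (d * Λ)) := by
    rw [hD]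
    ring
  have h7 : 1 / 2 ≤ d * Λ := by nlinarith
  -- The four terms of the expansion and the extra D add up to D(7l/2 + 3). With l ≤ 7dΛ and 1/2 ≤
  -- dΛ this is at most (49/2 + 6) D dΛ.
  have h8 : D * (7 / 2 * l + 3) ≤ D * (33 * (d * Λ)) := by
    gcongr
    nlinarith
  rw [h6]
  linarith

theorem radius_pos (hε : 0 < A.ε) : 0 < A.radius := Real.rpow_pos_of_pos hε _

theorem radius_pow (hn : 1 ≤ A.n) (hε : 0 < A.ε) : A.radius ^ A.n = A.ε := by
  rw [radius, one_div]
  exact Real.rpow_inv_natCast_pow hε.le (by omega)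

theorem mul_radius (hε : 0 < A.ε) : A.ε * A.radius = A.ε ^ (1 + 1 / (A.n : ℝ)) := by
  rw [Real.rpow_add hε, Real.rpow_one, radius]

theorem radius_le {b : ℝ} (hn : 1 ≤ A.n) (hε : 0 < A.ε) (hb : 0 ≤ b) (h : A.ε ≤ b ^ A.n) :
    A.radius ≤ b := by
  rw [← radius_pow hn hε] at h
  exact (pow_le_pow_iff_left₀ (radius_pos hε).le hb (by omega)).1 h

end Params

namespace Play

variable {X : Type*} [PseudoMetricSpace X] [MeasurableSpace X] {A : Params X} {m : Policy X}
  {Ω : Type*} [mΩ : MeasurableSpace Ω] {P : Measure Ω} {G : Play A m P}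

/-! ### The number of mistakes is of the order `(d / σ) T ε log (T + 1 / ε)` -/

theorem integral_loss_le [IsProbabilityMeasure P] {U : Measure X} [IsProbabilityMeasure U]
    {σ ε : ℝ} (hσ : 0 < σ) (hε : 0 ≤ ε) (hG : G.IsSmooth U σ) {π : Policy X}
    (hπ : U {x | m x ≠ π x} ≤ ENNReal.ofReal ε) {t : ℕ} (ht : t < A.T) :
    ∫ ω, loss m (G.inputs ω) t π.toExpert ∂P ≤ ε / σ := by
  -- The mentor policy is not assumed measurable, so the disagreement set is enlarged to a
  -- measurable set of the same measure.
  set B := toMeasurable U {x | m x ≠ π x} with hB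
  have hBm : MeasurableSet B := measurableSet_toMeasurable _ _
  have hUB : U.real B ≤ ε := by
    rw [Measure.real, hB, measure_toMeasurable]
    exact ENNReal.toReal_le_of_le_ofReal hε hπ
  have hBm' : MeasurableSet (G.input t ⁻¹' B) :=
    G.during.le t _ (G.measurable_input t ht hBm)
  calc ∫ ω, loss m (G.inputs ω) t π.toExpert ∂P
      ≤ ∫ ω, (G.input t ⁻¹' B).indicator (fun _ => (1 : ℝ)) ω ∂P := by
        refine integral_mono_of_nonneg (ae_of_all _ fun ω => loss_nonneg t _)
          ((integrable_const _).indicator hBm') (ae_of_all _ fun ω => ?_)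
        by_cases h : π (G.input t ω) = m (G.input t ω)
        · simp only [loss, Policy.toExpert, h, if_true]
          exact Set.indicator_nonneg (fun _ _ => zero_le_one) _
        · have hωB : ω ∈ G.input t ⁻¹' B :=
            subset_toMeasurable U {x | m x ≠ π x} (Ne.symm h)
          simp only [Set.indicator_of_mem hωB]
          exact loss_le_one t _
    _ = ∫ ω, (P[(G.input t ⁻¹' B).indicator (fun _ => (1 : ℝ)) | G.before t]) ω ∂P :=
        (integral_condExp (G.before.le t)).symm
    _ ≤ ∫ _, 1 / σ * U.real B ∂P :=
        integral_mono_ae integrable_condExp (integrable_const _) (hG t ht B hBm)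
    _ ≤ ε / σ := by
        rw [integral_const, probReal_univ, one_smul, one_div_mul_eq_div]
        gcongr

/-- Apply smoothness to the whole space. -/
theorem IsSmooth.le_one [IsProbabilityMeasure P] {U : Measure X} [IsProbabilityMeasure U]
    {σ : ℝ} (hσ : 0 < σ) (hG : G.IsSmooth U σ) (hT : 1 ≤ A.T) : σ ≤ 1 := by
  have h := hG 0 (by omega) Set.univ MeasurableSet.univ
  have h1 := integral_mono_ae integrable_condExp (integrable_const _) h
  rw [integral_condExp (G.before.le 0)] at h1
  simpa [one_le_inv₀ hσ] using h1

theorem integral_numMissed_le_log [IsProbabilityMeasure P] {C : Set (Policy X)} {d : ℕ} {σ : ℝ}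
    (hm : m ∈ C) (hT : 1 ≤ A.T) (hd : 1 ≤ d) (hε : 1 / A.T ≤ A.ε)
    (h : (0 < σ ∧ ∃ U : Measure X, IsProbabilityMeasure U ∧ G.IsSmooth U σ ∧
        IsSmoothCover U A.ε C A.cover ∧ (A.cover.card : ℝ) ≤ (41 / A.ε) ^ d) ∨
      (σ = 1 ∧ IsAdversarialCover A.T C A.cover ∧
        (A.cover.card : ℝ) ≤ (Real.exp 1 * A.T / d) ^ d)) :
    0 < σ ∧ σ ≤ 1 ∧
      ∫ ω, G.numMissed ω ∂P ≤ 33 * (d / σ * A.T * A.ε * Real.log (A.T + 1 / A.ε)) := by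
  have hσ : 0 < σ ∧ σ ≤ 1 := by
    rcases h with ⟨h0, U, hU, hG, -⟩ | ⟨rfl, -⟩
    exacts [⟨h0, hG.le_one h0 hT⟩, ⟨one_pos, le_rfl⟩]
  obtain ⟨hσ0, hσ1⟩ := hσ
  refine ⟨hσ0, hσ1, ?_⟩
  have hT1 : (1 : ℝ) ≤ A.T := by exact_mod_cast hT
  have hd1 : (1 : ℝ) ≤ d := by exact_mod_cast hd
  have hε0 := Params.pos_of_le hT hε
  rcases le_total A.ε 1 with hε1 | hε1
  · have hcard : ∀ e ∈ A.cover, (0 : ℝ) < A.cover.card := fun e he => by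
      exact_mod_cast Finset.card_pos.2 ⟨e, he⟩
    -- In the smooth case Y is the loss of one fixed member of the cover, with mean at most ε/σ. In
    -- the adversarial case the member depends on the run but never errs, so Y = 0.
    suffices hY : Real.log A.cover.card ≤ 7 * d * Real.log (A.T + 1 / A.ε) ∧ ∃ Y : ℕ → Ω → ℝ,
        (∀ t < A.T, Measurable[G.during t] (Y t)) ∧ (∀ t ω, 0 ≤ Y t ω) ∧ (∀ t ω, Y t ω ≤ 1) ∧
        (∀ ω, ∃ e ∈ A.cover, ∀ t < A.T, loss m (G.inputs ω) t e ≤ Y t ω) ∧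
        ∀ t < A.T, ∫ ω, Y t ω ∂P ≤ A.ε / σ by
      obtain ⟨hl, Y, hYm, hY0, hY1, hY, hδ⟩ := hY
      exact (integral_numMissed_le (Params.p_pos hT hε0) (Params.η_pos hT hε0) hYm hY0 hY1 hY
        hδ).trans (Params.hedge_bound_le hT hε hε1 hd hσ0 hσ1 hl)
    rcases h with ⟨-, U, hU, hG, hK, hN⟩ | ⟨rfl, hK, hN⟩
    · obtain ⟨π, -, hπK, hπ⟩ := hK.2 m hm
      exact ⟨log_le_of_le_smooth (hcard _ hπK) hT1 hε0 hε1 hN,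
        fun t ω => loss m (G.inputs ω) t π.toExpert, fun t ht => measurable_loss ht hπK,
        fun t ω => loss_nonneg t _, fun t ω => loss_le_one t _, fun ω => ⟨_, hπK, fun t _ => le_rfl⟩,
        fun t ht => integral_loss_le hσ0 hε0.le hG hπ ht⟩
    · obtain ⟨ω₀⟩ : Nonempty Ω := nonempty_of_isProbabilityMeasure P
      obtain ⟨e₀, he₀, -⟩ := hK m hm (G.inputs ω₀)
      refine ⟨log_le_of_le_adversarial hd (hcard _ he₀) hT1 hε0 hε1 hN, fun _ _ => 0,
        fun t _ => measurable_const, fun _ _ => le_rfl, fun _ _ => zero_le_one, fun ω => ?_,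
        fun t _ => by simpa using hε0.le⟩
      obtain ⟨e, he, h⟩ := hK m hm (G.inputs ω)
      exact ⟨e, he, fun t ht => by simp [loss, h t ht]⟩
  -- For ε ≥ 1 the trivial bound T suffices, since ε log(T + 1/ε) ≥ 1/2.
  · have h1 : ∫ ω, G.numMissed ω ∂P ≤ A.T := by
      simpa using integral_mono integrable_numMissed (integrable_const (A.T : ℝ))
        (numMissed_le (G := G))
    have h2 : 1 / 2 ≤ A.ε * Real.log (A.T + 1 / A.ε) := by
      have h := half_le_mul_log (T := 1) (ε := A.ε) le_rfl (by simpa using hε1)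
      rw [one_mul] at h
      refine h.trans (mul_le_mul_of_nonneg_left (Real.log_le_log ?_ ?_) hε0.le)
      · positivity
      · linarith
    have h3 : 1 ≤ d / σ := (one_le_div hσ0).2 (hσ1.trans hd1)
    have h4 : A.T * (1 / 2 : ℝ) ≤ A.T * (d / σ * (A.ε * Real.log (A.T + 1 / A.ε))) := by
      gcongr
      nlinarith
    calc ∫ ω, G.numMissed ω ∂P ≤ A.T := h1
      _ ≤ 33 * (A.T * (d / σ * (A.ε * Real.log (A.T + 1 / A.ε)))) := by linarith
      _ = _ := by ring

/-! ### Regret -/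

variable (G) in
/-- The runs in which the input of round `t` is unfamiliar. -/
def unfamiliar (t : ℕ) : Set Ω :=
  {ω | Unfamiliar A (stateAt A m (G.inputs ω) (G.coins ω) (G.draws ω) t) (G.input t ω)
    (G.guess t ω)}

theorem mem_unfamiliar {t : ℕ} {ω : Ω} : ω ∈ G.unfamiliar t ↔
    ∀ s < t, (ω ∈ G.unfamiliar s ∨ (A.storeAll = true ∧ G.coin s ω = true)) →
      m (G.input s ω) = G.guess t ω → A.radius < dist (G.input t ω) (G.input s ω) :=
  unfamiliar_iff

theorem act_of_mem {t : ℕ} {ω : Ω} (h : G.coin t ω = true ∨ ω ∈ G.unfamiliar t) :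
    G.act t ω = none := if_pos h

theorem act_of_not_mem {t : ℕ} {ω : Ω} (h : ¬ (G.coin t ω = true ∨ ω ∈ G.unfamiliar t)) :
    G.act t ω = some (G.guess t ω) := if_neg h

theorem agentPayoff_of_mem {t : ℕ} {ω : Ω} (h : G.coin t ω = true ∨ ω ∈ G.unfamiliar t) :
    G.agentPayoff t ω = G.mentorPayoff t ω := by
  rw [agentPayoff, act_of_mem h]
  rfl

theorem agentPayoff_of_not_mem {t : ℕ} {ω : Ω}
    (h : ¬ (G.coin t ω = true ∨ ω ∈ G.unfamiliar t)) :
    G.agentPayoff t ω = G.payoff t ω (G.input t ω) (G.guess t ω) := by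
  rw [agentPayoff, act_of_not_mem h]
  rfl

theorem agentPayoff_mem {t : ℕ} (ht : t < A.T) (ω : Ω) :
    G.agentPayoff t ω ∈ Set.Icc (0 : ℝ) 1 := by
  by_cases h : G.coin t ω = true ∨ ω ∈ G.unfamiliar t
  · rw [agentPayoff_of_mem h]
    exact G.payoff_mem t ht ω _ _
  · rw [agentPayoff_of_not_mem h]
    exact G.payoff_mem t ht ω _ _

theorem mentorPayoff_mem {t : ℕ} (ht : t < A.T) (ω : Ω) :
    G.mentorPayoff t ω ∈ Set.Icc (0 : ℝ) 1 :=
  G.payoff_mem t ht ω _ _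

/-- The agent loses payoff only by mistakes, and little by each of them. -/
theorem mentorPayoff_sub_le {L : ℝ} (hL : 0 ≤ L) (hG : G.LocalGeneralization L)
    (hr0 : 0 ≤ A.radius) {t : ℕ} (ht : t < A.T) (ω : Ω) : G.mentorPayoff t ω - G.agentPayoff t ω ≤
      L * A.radius * (G.missed t).indicator (fun _ => (1 : ℝ)) ω := by
  by_cases h : G.coin t ω = true ∨ ω ∈ G.unfamiliar t
  · rw [agentPayoff_of_mem h, sub_self]
    exact mul_nonneg (mul_nonneg hL hr0) (Set.indicator_nonneg (fun _ _ => zero_le_one) _)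
  · rw [agentPayoff_of_not_mem h, mentorPayoff]
    rw [not_or, mem_unfamiliar] at h
    push Not at h
    -- Round s is stored within the radius, and its mentor action is the guess. The action taken is
    -- thus the mentor's action at a nearby input, as local generalization requires.
    obtain ⟨hc, s, hs, -, hy, hd⟩ := h
    by_cases hg : G.guess t ω = m (G.input t ω)
    · rw [hg, sub_self, Set.indicator_of_notMem, mul_zero]
      exact fun h => h.2 hg
    · rw [Set.indicator_of_mem (show ω ∈ G.missed t from ⟨by simpa using hc, hg⟩), mul_one, ← hy]
      exact (le_abs_self _).trans ((hG t ht ω _ _).trans (by gcongr))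

theorem addRegret_le {L : ℝ} (hL : 0 ≤ L) (hG : G.LocalGeneralization L)
    (hr0 : 0 ≤ A.radius) (ω : Ω) :
    G.addRegret ω ≤ L * A.radius * G.numMissed ω := by
  rw [addRegret, ← Finset.sum_sub_distrib, numMissed, Finset.mul_sum]
  exact Finset.sum_le_sum fun t ht => mentorPayoff_sub_le hL hG hr0 (Finset.mem_range.1 ht) ω

theorem half_le_agentPayoff {L μmin : ℝ} (hL : 0 ≤ L) (hG : G.LocalGeneralization L)
    (hr0 : 0 ≤ A.radius) (hr : L * A.radius ≤ μmin / 2) {t : ℕ} (ht : t < A.T) {ω : Ω}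
    (hμ : μmin ≤ G.mentorPayoff t ω) : μmin / 2 ≤ G.agentPayoff t ω := by
  have h1 := mentorPayoff_sub_le hL hG hr0 ht ω
  have h2 : L * A.radius * (G.missed t).indicator (fun _ => (1 : ℝ)) ω ≤ L * A.radius :=
    mul_le_of_le_one_right (mul_nonneg hL hr0) (Set.indicator_le_self' (fun _ _ => zero_le_one) ω)
  linarith

/-- From log y ≤ y - 1 for the ratio of the payoffs; the factor 2/μmin is the reciprocal of the
lower bound μmin/2 for the agent's payoff. -/
theorem log_sub_log_le {L μmin : ℝ} (hL : 0 ≤ L) (hμ0 : 0 < μmin) (hG : G.LocalGeneralization L)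
    (hr0 : 0 ≤ A.radius) (hr : L * A.radius ≤ μmin / 2) {t : ℕ} (ht : t < A.T) {ω : Ω}
    (hμ : μmin ≤ G.mentorPayoff t ω) :
    Real.log (G.mentorPayoff t ω) - Real.log (G.agentPayoff t ω) ≤
      2 * (L * A.radius) / μmin * (G.missed t).indicator (fun _ => (1 : ℝ)) ω := by
  have h1 := mentorPayoff_sub_le hL hG hr0 ht ω
  have h2 := half_le_agentPayoff hL hG hr0 hr ht hμ
  have h3 : 0 < G.agentPayoff t ω := (half_pos hμ0).trans_le h2
  have h4 : 0 ≤ (G.missed t).indicator (fun _ => (1 : ℝ)) ω :=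
    Set.indicator_nonneg (fun _ _ => zero_le_one) _
  rw [← Real.log_div (hμ0.trans_le hμ).ne' h3.ne']
  calc Real.log (G.mentorPayoff t ω / G.agentPayoff t ω)
      ≤ G.mentorPayoff t ω / G.agentPayoff t ω - 1 :=
        Real.log_le_sub_one_of_pos (div_pos (hμ0.trans_le hμ) h3)
    _ = (G.mentorPayoff t ω - G.agentPayoff t ω) / G.agentPayoff t ω := by field_simp
    _ ≤ (L * A.radius * (G.missed t).indicator (fun _ => (1 : ℝ)) ω) / G.agentPayoff t ω := by
        gcongr
    _ ≤ (L * A.radius * (G.missed t).indicator (fun _ => (1 : ℝ)) ω) / (μmin / 2) := by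
        gcongr
    _ = _ := by
        field_simp

theorem measurable_mentorPayoff {t : ℕ} (ht : t < A.T) : Measurable (G.mentorPayoff t) := by
  have h : ∀ y, Measurable fun ω => G.payoff t ω (G.input t ω) y := fun y =>
    (G.measurable_payoff t ht y).mono (G.during.le t) le_rfl
  have hm : Measurable fun ω => m (G.input t ω) :=
    (G.measurable_mentor t ht).mono (G.during.le t) le_rfl
  have : G.mentorPayoff t = fun ω => if m (G.input t ω) = true then
      G.payoff t ω (G.input t ω) true else G.payoff t ω (G.input t ω) false := by
    ext ω
    rw [mentorPayoff]
    cases m (G.input t ω) <;> simp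
  rw [this]
  exact Measurable.ite (hm (measurableSet_singleton true)) (h true) (h false)

/-! ### Measurability of the payoffs and the expected regrets -/

variable [OpensMeasurableSpace X] [SecondCountableTopology X]

theorem measurableSet_unfamiliar : ∀ {t : ℕ}, t < A.T → MeasurableSet (G.unfamiliar t) := by
  intro t
  induction t using Nat.strong_induction_on with
  | _ t ih =>
    intro ht
    have hx : ∀ s ≤ t, Measurable (G.input s) := fun s hs =>
      (G.measurable_input s (hs.trans_lt ht)).mono (G.during.le s) le_rfl
    have hset : G.unfamiliar t = ⋂ s ∈ Finset.range t,
        (G.unfamiliar s ∪ {ω | A.storeAll = true ∧ G.coin s ω = true})ᶜ ∪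
          ({ω | m (G.input s ω) = G.guess t ω}ᶜ ∪
            {ω | A.radius < dist (G.input t ω) (G.input s ω)}) := by
      ext ω
      rw [mem_unfamiliar]
      simp only [Set.mem_iInter, Finset.mem_range, Set.mem_union, Set.mem_compl_iff,
        Set.mem_ofPred_eq]
      refine forall₂_congr fun s _ => ?_
      tauto
    rw [hset]
    refine Finset.measurableSet_biInter _ fun s hs => ?_
    have hst := Finset.mem_range.1 hs
    have hsT := hst.trans ht
    refine MeasurableSet.union (MeasurableSet.compl ((ih s hst hsT).union ?_))
      (MeasurableSet.union (MeasurableSet.compl ?_) ?_)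
    · exact (MeasurableSet.const _).inter (measurableSet_coin hsT)
    · exact measurableSet_eq_fun ((G.measurable_mentor s hsT).mono (G.during.le s) le_rfl)
        ((measurable_guess ht).mono (G.before.le _) le_rfl)
    · exact measurableSet_lt measurable_const ((hx t le_rfl).dist (hx s hst.le))

theorem measurable_agentPayoff {t : ℕ} (ht : t < A.T) : Measurable (G.agentPayoff t) := by
  classical
  have h : ∀ y, Measurable fun ω => G.payoff t ω (G.input t ω) y := fun y =>
    (G.measurable_payoff t ht y).mono (G.during.le t) le_rfl
  have hg : Measurable (G.guess t) := (measurable_guess ht).mono (G.before.le _) le_rfl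
  have : G.agentPayoff t = fun ω => if G.coin t ω = true ∨ ω ∈ G.unfamiliar t then
      G.mentorPayoff t ω else if G.guess t ω = true then
      G.payoff t ω (G.input t ω) true else G.payoff t ω (G.input t ω) false := by
    ext ω
    split_ifs with h1 h2
    · exact agentPayoff_of_mem h1
    · rw [agentPayoff_of_not_mem h1, h2]
    · rw [agentPayoff_of_not_mem h1, Bool.eq_false_of_not_eq_true h2]
  rw [this]
  exact Measurable.ite ((measurableSet_coin ht).union (measurableSet_unfamiliar ht))
    (measurable_mentorPayoff ht)
    (Measurable.ite (hg (measurableSet_singleton true)) (h true) (h false))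

variable [IsProbabilityMeasure P]

theorem expectationLE_addRegret {L b : ℝ} (hL : 0 ≤ L) (hG : G.LocalGeneralization L)
    (hr0 : 0 ≤ A.radius) (hb : L * A.radius * ∫ ω, G.numMissed ω ∂P ≤ b) :
    ExpectationLE P (fun ω => (G.addRegret ω : EReal)) b := by
  have hi : Integrable G.addRegret P := by
    refine Integrable.sub (integrable_finsetSum _ fun t ht => ?_)
      (integrable_finsetSum _ fun t ht => ?_)
    · have ht := Finset.mem_range.1 ht
      exact integrable_of_mem_Icc (measurable_mentorPayoff ht) (fun ω => (mentorPayoff_mem ht ω).1)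
        fun ω => (mentorPayoff_mem ht ω).2
    · have ht := Finset.mem_range.1 ht
      exact integrable_of_mem_Icc (measurable_agentPayoff ht) (fun ω => (agentPayoff_mem ht ω).1)
        fun ω => (agentPayoff_mem ht ω).2
  refine ⟨ae_of_all _ fun ω => ⟨EReal.coe_ne_top _, EReal.coe_ne_bot _⟩, by simpa using hi, ?_⟩
  simp only [EReal.toReal_coe]
  refine (integral_mono hi (integrable_numMissed.const_mul _) (addRegret_le hL hG hr0)).trans ?_
  rwa [integral_const_mul]

theorem expectationLE_mulRegret {L μmin b : ℝ} (hL : 0 ≤ L) (hμ0 : 0 < μmin)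
    (hG : G.LocalGeneralization L) (hr0 : 0 ≤ A.radius) (hr : L * A.radius ≤ μmin / 2)
    (hμ : ∀ t < A.T, ∀ ω, μmin ≤ G.mentorPayoff t ω)
    (hb : 2 * (L * A.radius) / μmin * ∫ ω, G.numMissed ω ∂P ≤ b) :
    ExpectationLE P G.mulRegret b := by
  have hlow : ∀ t < A.T, ∀ ω, μmin / 2 ≤ G.agentPayoff t ω := fun t ht ω =>
    half_le_agentPayoff hL hG hr0 hr ht (hμ t ht ω)
  have hR : ∀ ω, G.mulRegret ω = ((∑ t ∈ Finset.range A.T,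
      (Real.log (G.mentorPayoff t ω) - Real.log (G.agentPayoff t ω)) : ℝ) : EReal) := fun ω => by
    have hpos : ∀ t < A.T, 0 < G.agentPayoff t ω := fun t ht => (half_pos hμ0).trans_le (hlow t ht ω)
    rw [mulRegret, if_pos hpos, Finset.sum_sub_distrib, Real.log_prod, Real.log_prod]
    · exact fun t ht => (hpos t (Finset.mem_range.1 ht)).ne'
    · exact fun t ht => (hμ0.trans_le (hμ t (Finset.mem_range.1 ht) ω)).ne'
  -- The regret can be negative, so its integrability needs two-sided bounds: logarithms of payoffs
  -- lie between log(μmin/2) and 0.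
  have hlog : ∀ f : Ω → ℝ, Measurable f → (∀ ω, μmin / 2 ≤ f ω) → (∀ ω, f ω ≤ 1) →
      Integrable (fun ω => Real.log (f ω)) P := fun f hf h0 h1 => by
    refine Integrable.of_bound hf.log.aestronglyMeasurable (-Real.log (μmin / 2))
      (ae_of_all _ fun ω => ?_)
    rw [Real.norm_of_nonpos (Real.log_nonpos ((half_pos hμ0).le.trans (h0 ω)) (h1 ω)), neg_le_neg_iff]
    exact Real.log_le_log (half_pos hμ0) (h0 ω)
  have hi : Integrable (fun ω => ∑ t ∈ Finset.range A.T,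
      (Real.log (G.mentorPayoff t ω) - Real.log (G.agentPayoff t ω))) P := by
    refine integrable_finsetSum _ fun t ht => ?_
    have ht := Finset.mem_range.1 ht
    exact (hlog _ (measurable_mentorPayoff ht) (fun ω => (half_le_self hμ0.le).trans (hμ t ht ω))
      fun ω => (mentorPayoff_mem ht ω).2).sub
      (hlog _ (measurable_agentPayoff ht) (hlow t ht) fun ω => (agentPayoff_mem ht ω).2)
  refine ⟨ae_of_all _ fun ω => ?_, ?_, ?_⟩
  · rw [hR]
    exact ⟨EReal.coe_ne_top _, EReal.coe_ne_bot _⟩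
  · simpa only [hR, EReal.toReal_coe] using hi
  · simp only [hR, EReal.toReal_coe]
    refine (integral_mono hi (integrable_numMissed.const_mul (2 * (L * A.radius) / μmin))
      fun ω => ?_).trans (by rwa [integral_const_mul])
    rw [numMissed, Finset.mul_sum]
    exact Finset.sum_le_sum fun t ht => log_sub_log_le hL hμ0 hG hr0 hr (Finset.mem_range.1 ht)
      (hμ t (Finset.mem_range.1 ht) ω)

end Play

namespace Play

/-! ### The number of queries -/

section Queries

variable {n : ℕ} {X : Set (EuclideanSpace ℝ (Fin n))} {A : Params X} {m : Policy X} {Ω : Type*}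
  [mΩ : MeasurableSpace Ω] {P : Measure Ω} {G : Play A m P}

variable (G) in
/-- The number of Hedge queries. -/
noncomputable def numHedgeQueries (ω : Ω) : ℝ :=
  ∑ t ∈ Finset.range A.T, {ω | G.coin t ω = true}.indicator (fun _ => (1 : ℝ)) ω

theorem dist_le_inputDiam {s t : ℕ} (hs : s < A.T) (ht : t < A.T) (ω : Ω) :
    dist (G.input s ω) (G.input t ω) ≤ G.inputDiam ω :=
  Metric.dist_le_diam_of_mem ((Set.finite_Iio A.T).image _).isBounded
    (Set.mem_image_of_mem _ hs) (Set.mem_image_of_mem _ ht)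

open Classical in
/-- Unfamiliar inputs that are labelled correctly by Hedge are far apart. -/
theorem card_unfamiliar_le (hr : 0 < A.radius) (b : Bool) (ω : Ω) :
    (((Finset.range A.T).filter fun t => ω ∈ G.unfamiliar t ∧ G.guess t ω = b ∧
      m (G.input t ω) = b).card : ℝ) ≤ (1 + 2 * G.inputDiam ω / A.radius) ^ n := by
  have hlt : ∀ s t, s < t → (ω ∈ G.unfamiliar s ∧ G.guess s ω = b ∧ m (G.input s ω) = b) →
      (ω ∈ G.unfamiliar t ∧ G.guess t ω = b ∧ m (G.input t ω) = b) →
      A.radius < dist (G.input t ω) (G.input s ω) := fun s t hst hs ht =>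
    mem_unfamiliar.1 ht.1 s hst (Or.inl hs.1) (hs.2.2.trans ht.2.1.symm)
  refine card_le_of_dist_gt (x := fun t => (G.input t ω : EuclideanSpace ℝ (Fin n))) hr
    Metric.diam_nonneg (fun s hs t ht hst => ?_) fun s hs t ht => ?_
  · have hs := (Finset.mem_filter.1 hs).2
    have ht := (Finset.mem_filter.1 ht).2
    change A.radius < dist (G.input s ω) (G.input t ω)
    rcases lt_or_gt_of_ne hst with h | h
    · rw [dist_comm]
      exact hlt s t h hs ht
    · exact hlt t s h ht hs
  · exact dist_le_inputDiam (Finset.mem_range.1 (Finset.mem_filter.1 hs).1)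
      (Finset.mem_range.1 (Finset.mem_filter.1 ht).1) ω

/-- An unfamiliar input with a wrong guess may lie close to earlier inputs, because its guess is
compared with stored labels other than its own; such rounds are charged to the Hedge queries or the
misses. Correct guesses are counted for each of the two labels by `card_unfamiliar_le`, hence the
factor 2. -/
theorem numQueries_le (hr : 0 < A.radius) (ω : Ω) : (G.numQueries ω : ℝ) ≤
    G.numHedgeQueries ω + G.numMissed ω + 2 * (1 + 2 * G.inputDiam ω / A.radius) ^ n := by
  classical
  have hsum : (G.numQueries ω : ℝ) ≤ ∑ t ∈ Finset.range A.T,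
      ({ω | G.coin t ω = true}.indicator (fun _ => (1 : ℝ)) ω
        + (G.missed t).indicator (fun _ => (1 : ℝ)) ω
        + ((if ω ∈ G.unfamiliar t ∧ G.guess t ω = true ∧ m (G.input t ω) = true then 1 else 0)
        + if ω ∈ G.unfamiliar t ∧ G.guess t ω = false ∧ m (G.input t ω) = false then 1 else 0)) := by
    rw [numQueries, Finset.card_filter]
    push_cast
    refine Finset.sum_le_sum fun t _ => ?_
    have hact : G.act t ω = none → G.coin t ω = true ∨ ω ∈ G.unfamiliar t := fun h => by
      by_contra h'
      rw [act_of_not_mem h'] at h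
      simp at h
    simp only [Set.indicator_apply, missed, Set.mem_ofPred_eq]
    rcases Bool.eq_false_or_eq_true (G.coin t ω) with hc | hc <;>
      rcases Bool.eq_false_or_eq_true (G.guess t ω) with hg | hg <;>
      rcases Bool.eq_false_or_eq_true (m (G.input t ω)) with hm | hm <;>
      by_cases hu : ω ∈ G.unfamiliar t <;> by_cases ha : G.act t ω = none <;> simp_all
  refine hsum.trans ?_
  rw [Finset.sum_add_distrib, Finset.sum_add_distrib, Finset.sum_add_distrib]
  have h1 := card_unfamiliar_le (G := G) hr true ω
  have h2 := card_unfamiliar_le (G := G) hr false ω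
  rw [Finset.card_filter] at h1 h2
  push_cast at h1 h2
  rw [numHedgeQueries, numMissed]
  linarith

theorem measurable_numHedgeQueries : Measurable G.numHedgeQueries :=
  Finset.measurable_sum _ fun _ ht =>
    measurable_const.indicator (measurableSet_coin (Finset.mem_range.1 ht))

theorem integrable_numHedgeQueries [IsProbabilityMeasure P] : Integrable G.numHedgeQueries P :=
  integrable_finsetSum _ fun _ ht =>
    (integrable_const (1 : ℝ)).indicator (measurableSet_coin (Finset.mem_range.1 ht))

theorem integral_numHedgeQueries [IsProbabilityMeasure P] :
    ∫ ω, G.numHedgeQueries ω ∂P = A.T * A.p := by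
  simp only [numHedgeQueries]
  rw [integral_finsetSum _ fun t ht => (integrable_const (1 : ℝ)).indicator
    (measurableSet_coin (Finset.mem_range.1 ht))]
  have h : ∀ t ∈ Finset.range A.T,
      ∫ ω, {ω | G.coin t ω = true}.indicator (fun _ => (1 : ℝ)) ω ∂P = A.p := fun t ht => by
    rw [← integral_condExp (G.during.le t), integral_congr_ae (G.coin_law t (Finset.mem_range.1 ht))]
    simp
  rw [Finset.sum_congr rfl h]
  simp

theorem numHedgeQueries_nonneg (ω : Ω) : 0 ≤ G.numHedgeQueries ω :=
  Finset.sum_nonneg fun _ _ => Set.indicator_nonneg (fun _ _ => zero_le_one) _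

/-- Stated for extended nonnegative integrals because the diameter may have an infinite n-th moment;
its measurability is not needed. The constants come from (1 + y)^n ≤ 2^n(1 + y^n) with y = 2D/r and
r^n = ε. -/
theorem lintegral_numQueries_le [IsProbabilityMeasure P] {a b : ℝ} (hn : 1 ≤ n) (hAn : A.n = n)
    (hε : 0 < A.ε) (hb : 2 * 4 ^ n ≤ b)
    (ha : ∫ ω, G.numHedgeQueries ω ∂P + ∫ ω, G.numMissed ω ∂P + 2 * 2 ^ n ≤ a) :
    ∫⁻ ω, (G.numQueries ω : ℝ≥0∞) ∂P ≤ ENNReal.ofReal a +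
      ENNReal.ofReal (b / A.ε) * ∫⁻ ω, ENNReal.ofReal (G.inputDiam ω ^ n) ∂P := by
  have hr := Params.radius_pos hε
  have hrn : A.radius ^ n = A.ε := by
    have h := Params.radius_pow (A := A) (by omega) hε
    rwa [hAn] at h
  have hpt : ∀ ω, (G.numQueries ω : ℝ≥0∞) ≤
      ENNReal.ofReal (G.numHedgeQueries ω + G.numMissed ω + 2 * 2 ^ n) +
        ENNReal.ofReal (b / A.ε) * ENNReal.ofReal (G.inputDiam ω ^ n) := fun ω => by
    have hD : 0 ≤ G.inputDiam ω := Metric.diam_nonneg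
    have hb0 : 0 ≤ b := le_trans (by positivity) hb
    have h0 : 0 ≤ G.numHedgeQueries ω + G.numMissed ω + 2 * 2 ^ n :=
      add_nonneg (add_nonneg (numHedgeQueries_nonneg ω) (numMissed_nonneg ω)) (by positivity)
    rw [← ENNReal.ofReal_mul (by positivity), ← ENNReal.ofReal_add h0 (by positivity),
      ← ENNReal.ofReal_natCast]
    refine ENNReal.ofReal_le_ofReal ((numQueries_le hr ω).trans ?_)
    have h1 : (1 + 2 * G.inputDiam ω / A.radius) ^ n ≤
        2 ^ n + 4 ^ n / A.ε * G.inputDiam ω ^ n := by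
      calc (1 + 2 * G.inputDiam ω / A.radius) ^ n
          ≤ 2 ^ (n - 1) * (1 ^ n + (2 * G.inputDiam ω / A.radius) ^ n) :=
            add_pow_le zero_le_one (by positivity) n
        _ ≤ 2 ^ n * (1 ^ n + (2 * G.inputDiam ω / A.radius) ^ n) := by
            gcongr
            · exact one_le_two
            · omega
        _ = 2 ^ n + 4 ^ n / A.ε * G.inputDiam ω ^ n := by
            rw [div_pow, mul_pow, hrn, show (4 : ℝ) = 2 * 2 by norm_num, mul_pow]
            ring
    have h2 : 2 * (4 ^ n / A.ε * G.inputDiam ω ^ n) ≤ b / A.ε * G.inputDiam ω ^ n := by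
      rw [← mul_assoc, mul_div_assoc']
      gcongr
    linarith
  refine (lintegral_mono hpt).trans ?_
  have hmeas : Measurable fun ω =>
      ENNReal.ofReal (G.numHedgeQueries ω + G.numMissed ω + 2 * 2 ^ n) :=
    ((measurable_numHedgeQueries.add measurable_numMissed).add_const _).ennreal_ofReal
  rw [lintegral_add_left hmeas, lintegral_const_mul' _ _ ENNReal.ofReal_ne_top]
  gcongr
  have hi : Integrable (fun ω => G.numHedgeQueries ω + G.numMissed ω) P :=
    integrable_numHedgeQueries.add integrable_numMissed
  have hi' : Integrable (fun ω => G.numHedgeQueries ω + G.numMissed ω + 2 * 2 ^ n) P :=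
    hi.add (integrable_const _)
  rw [← ofReal_integral_eq_lintegral_ofReal hi'
    (ae_of_all _ fun ω => add_nonneg (add_nonneg (numHedgeQueries_nonneg ω) (numMissed_nonneg ω))
      (by positivity))]
  refine ENNReal.ofReal_le_ofReal (le_trans (le_of_eq ?_) ha)
  rw [integral_add hi (integrable_const _),
    integral_add integrable_numHedgeQueries integrable_numMissed]
  simp

end Queries

end Play

end AskForHelp

/-! ### Assembly of the theorem and choice of the constants -/

open AskForHelp in
theorem mainTheorem5 :
    -- the covers that the algorithm asks for exist
    (∀ (n : ℕ) (X : Set (EuclideanSpace ℝ (Fin n))) (C : Set (Policy X)) (d : ℕ), 1 ≤ d →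
      (∀ (U : Measure X) (ε : ℝ), IsProbabilityMeasure U → (∀ π ∈ C, Measurable π) →
        vcDim C = d → 0 < ε → ε ≤ 41 →
        ∃ K : Finset (Expert X), IsSmoothCover U ε C K ∧ (K.card : ℝ) ≤ (41 / ε) ^ d) ∧
      (∀ T : ℕ, littlestoneDim C = d → d ≤ T →
        ∃ K : Finset (Expert X), IsAdversarialCover T C K ∧
          (K.card : ℝ) ≤ (Real.exp 1 * T / d) ^ d)) ∧
    -- with any such cover the algorithm has the claimed guarantees
    ∃ c : ℝ, 0 < c ∧ ∀ n : ℕ, 1 ≤ n → ∃ c' : ℝ, 0 < c' ∧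
      ∀ (X : Set (EuclideanSpace ℝ (Fin n))) (C : Set (Policy X)) (m : Policy X) (T d : ℕ)
        (ε L μmin σ : ℝ) (K : Finset (Expert X)) (storeAll : Bool)
        (Ω : Type*) (mΩ : MeasurableSpace Ω) (P : Measure Ω) (_ : IsProbabilityMeasure P)
        (G : Play ⟨n, T, ε, K, storeAll⟩ m P),
        m ∈ C → 1 ≤ T → 1 ≤ d → 0 < L → 0 < μmin →
        1 / T ≤ ε → ε ≤ (μmin / (2 * L)) ^ n →
        G.LocalGeneralization L →
        (∀ t < T, ∀ ω, μmin ≤ G.mentorPayoff t ω) →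
        ((vcDim C = d ∧ 0 < σ ∧ ∃ U : Measure X, IsProbabilityMeasure U ∧ G.IsSmooth U σ ∧
            IsSmoothCover U ε C K ∧ (K.card : ℝ) ≤ (41 / ε) ^ d) ∨
          (littlestoneDim C = d ∧ σ = 1 ∧
            IsAdversarialCover T C K ∧ (K.card : ℝ) ≤ (Real.exp 1 * T / d) ^ d)) →
        ExpectationLE P G.mulRegret
          (c * (d * L / (σ * μmin) * T * ε ^ (1 + 1 / (n : ℝ)) * Real.log (T + 1 / ε))) ∧
        ExpectationLE P (fun ω => (G.addRegret ω : EReal))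
          (c * (d * L / σ * T * ε ^ (1 + 1 / (n : ℝ)) * Real.log (T + 1 / ε))) ∧
        ∫⁻ ω, (G.numQueries ω : ℝ≥0∞) ∂P ≤
          ENNReal.ofReal (c' * (√(T / ε) + d / σ * T * ε * Real.log (T + 1 / ε))) +
            ENNReal.ofReal (c' / ε) * ∫⁻ ω, ENNReal.ofReal (G.inputDiam ω ^ n) ∂P := by
  -- The constant 33 of the mistake bound is doubled for the multiplicative regret. In c' the factor
  -- 4^n comes from the packing bound, and 100 leaves room.
  refine ⟨fun n X C d hd => ⟨fun U ε _ hm hC hε0 hε => exists_isSmoothCover U hd hm hC hε0 hε,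
    fun T hC hT => exists_isAdversarialCover hd hC hT⟩, 66, by norm_num, fun n hn =>
    ⟨100 * 4 ^ n, by positivity, ?_⟩⟩
  intro X C m T d ε L μmin σ K storeAll Ω mΩ P _ G hm hT hd hL hμ0 hε hεL hG hμ hcase
  have hT1 : (1 : ℝ) ≤ T := by exact_mod_cast hT
  have hd1 : (1 : ℝ) ≤ d := by exact_mod_cast hd
  let A : Params X := ⟨n, T, ε, K, storeAll⟩
  have hε0 : 0 < ε := Params.pos_of_le (A := A) hT hε
  obtain ⟨hσ0, hσ1, hM⟩ := Play.integral_numMissed_le_log (G := G) (σ := σ) hm hT hd hε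
    (hcase.imp (fun h => h.2) fun h => h.2)
  have hr0 : 0 < A.radius := Params.radius_pos hε0
  have hrad : ε * A.radius = ε ^ (1 + 1 / (n : ℝ)) := Params.mul_radius (A := A) hε0
  have hr : L * A.radius ≤ μmin / 2 := by
    have h := Params.radius_le (A := A) (b := μmin / (2 * L)) hn hε0 (by positivity) hεL
    rw [le_div_iff₀ (by positivity)] at h
    linarith
  change ∫ ω, G.numMissed ω ∂P ≤ 33 * (d / σ * T * ε * Real.log (T + 1 / ε)) at hM
  have hΛ : 1 / 2 ≤ T * ε * Real.log (T + 1 / ε) := half_le_mul_log hT1 hε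
  rw [← hrad]
  set Λ := Real.log (T + 1 / ε)
  have hΛ0 : 0 ≤ Λ := log_add_nonneg hT1 hε0
  refine ⟨?_, ?_, ?_⟩
  · refine Play.expectationLE_mulRegret hL.le hμ0 hG hr0.le hr hμ ?_
    calc 2 * (L * A.radius) / μmin * ∫ ω, G.numMissed ω ∂P
        ≤ 2 * (L * A.radius) / μmin * (33 * (d / σ * T * ε * Λ)) := by gcongr
      _ = 66 * (d * L / (σ * μmin) * T * (ε * A.radius) * Λ) := by
          field_simp
          ring
  · refine Play.expectationLE_addRegret hL.le hG hr0.le ?_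
    calc L * A.radius * ∫ ω, G.numMissed ω ∂P
        ≤ L * A.radius * (33 * (d / σ * T * ε * Λ)) := by gcongr
      _ = 33 * (d * L / σ * T * (ε * A.radius) * Λ) := by ring
      _ ≤ 66 * (d * L / σ * T * (ε * A.radius) * Λ) := by
          gcongr
          norm_num
  · refine Play.lintegral_numQueries_le hn rfl hε0 (by gcongr; norm_num) ?_
    have h1 : A.T * A.p = √(T / ε) := Params.mul_p_eq (A := A) hT hε0
    rw [Play.integral_numHedgeQueries, h1]
    -- Allows the additive 2 · 2^n of the packing bound to be absorbed into the mistake term.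
    have h2 : 1 / 2 ≤ d / σ * T * ε * Λ := by
      have h3 : 1 ≤ d / σ := (one_le_div hσ0).2 (hσ1.trans hd1)
      calc 1 / 2 ≤ T * ε * Λ := hΛ
        _ ≤ d / σ * (T * ε * Λ) := le_mul_of_one_le_left (by positivity) h3
        _ = _ := by ring
    have h3 : (1 : ℝ) ≤ 4 ^ n := one_le_pow₀ (by norm_num)
    have h4 : (2 : ℝ) ^ n ≤ 4 ^ n := by
      gcongr
      norm_num
    have h5 := Real.sqrt_nonneg (T / ε)
    have h6 : √(T / ε) ≤ 100 * 4 ^ n * √(T / ε) := le_mul_of_one_le_left h5 (by linarith)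
    have h7 : 33 * (d / σ * T * ε * Λ) ≤ 33 * (4 ^ n * (d / σ * T * ε * Λ)) :=
      mul_le_mul_of_nonneg_left (le_mul_of_one_le_left (le_trans (by norm_num) h2) h3)
        (by norm_num)
    have h8 : (2 : ℝ) * 2 ^ n ≤ 4 * (4 ^ n * (d / σ * T * ε * Λ)) := by
      nlinarith
    have h9 : 0 ≤ 4 ^ n * (d / σ * T * ε * Λ) := by positivity
    linarith
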